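/- Notation. Let $n\ge 2$, let $P$ be a symmetric $n\times n$ transition matrix (nonnegative entries, all row sums $1$) and let $\beta>0$. For $S\subseteq[n]$, $S\ne\emptyset$, put $\operatorname{mass}(S)=\frac1{|S|}\sum_{i,j\in S}P_{ij}$. For $\emptyset\ne R\subsetneq V\subseteq[n]$ put $$h_V(R)=\frac{\sum_{i\in R,\,j\in V\setminus R}P_{ij}}{\min(|R|,|V\setminus R|)},\qquad g_V(R)=\frac{\sum_{i,j\in V}\delta_R(i,j)P_{ij}}{\sum_{i,j\in V}\delta_R(i,j)},$$ where $\delta_R(i,j)=0$ if $i,j$ are both in $R$ or both outside $R$, and $\delta_R(i,j)=1$ otherwise. Logarithms are natural, and $C>0$ is a constant, the distortion constant of the embeddings used below. Subroutine $\mathrm{FindComp}(V,T)$, for $T\subsetneq V\subseteq[n]$, $|V|\ge2$. (1) Take a minimiser $\delta$ of $\sum_{i,j\in V}\delta_{ij}P_{ij}$ over all pseudometrics $\delta$ on $V$ (nonnegative, symmetric, zero on the diagonal, with the triangle inequality) such that $\sum_{i,j\in V}\delta_{ij}=1$, $\delta_{ij}=0$ for $i,j\in T$, and $\delta_{ik}=\delta_{jk}$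 for $i,j\in T$, $k\in V$. (2) Take $f:V\to\mathbb R^m$, for some $m$, with $\delta_{ij}\le\|f(i)-f(j)\|_1\le C\log|V|\,\delta_{ij}$ for all $i,j\in V$. (3) Write $\|f(i)-f(j)\|_1=\sum_{l=1}^r\alpha_l\,\delta_{S_l}(i,j)$ for all $i,j\in V$, with $\alpha_l>0$ and distinct sets $\emptyset\ne S_l\subsetneq V$. (4) Among $S_1,\dots,S_r$ take one of least value $g_V$, and return it or its complement in $V$, whichever is disjoint from $T$. Choices that are not prescribed are arbitrary. Extract Component with input $T\subseteq[n]$. If $T=[n]$, return False. Otherwise let $S=\mathrm{FindComp}([n],T)$. If $h_{[n]}(S)\ge\beta/8$, replace $S$ by $[n]\setminus T$ and, if then $\operatorname{mass}(S)\le1-\beta/8$, return False. While $|S|>1$: let $S'=\mathrm{FindComp}(S,\emptyset)$; if $h_S(S')\ge\beta/(8\log n)$, leave the loop; otherwise replace $S$ by $S'$ if $\operatorname{mass}(S')\ge\operatorname{mass}(S\setminus S')$, and by $S\setminus S'$ if not. After the loop, return $S$. Partition Graph. Start with $\mathcal S=\emptyset$, $T=\emptyset$. As long as Extract Component with input $T$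 returns a set $S$, add $S$ to $\mathcal S$ and replace $T$ by $T\cup S$. When it returns False, return $(\mathcal S,[n]\setminus T)$. Lemma. There is an absolute constant $C_0>0$ such that for every $C\ge C_0$ there is a constant $c>0$, depending only on $C$, for which the following holds for all $n$, $P$, $\beta$ as above. Partition Graph never gets stuck (the choices asked for in FindComp can always be made) and always terminates after finitely many steps, whatever choices are made. Whatever pair $(\mathcal S,T)$ it returns, the sets in $\mathcal S$ are nonempty and, together with the (possibly empty) set $T$, form a partition of $[n]$. For every $S\in\mathcal S$, $$\frac{\sum_{i,j\in S}P_{ij}}{|S|}\ge1-\beta\qquad\text{and}\qquad\frac{\sum_{i\in R,\,j\in S\setminus R}P_{ij}}{\min(|R|,|S\setminus R|)}\ge c\,\frac{\beta}{\log^2n}\quad\text{for all }\emptyset\ne R\subsetneq S,$$ and $$\frac{\sum_{i\in R,\,j\notin R}P_{ij}}{|R|}\ge c\,\frac{\beta}{\log n}\qquad\text{for all }\emptyset\ne R\subseteq T.$$ -/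

import Mathlib

open scoped BigOperators

noncomputable section

namespace PartitionGraph

variable {n : ℕ}

/-- The cut metric of `S`: `0` if `i`, `j` lie on the same side of the cut, `1` otherwise. -/
def cutMetric (S : Finset (Fin n)) (i j : Fin n) : ℝ :=
  if (i ∈ S ↔ j ∈ S) then 0 else 1

/-- The total weight `∑_{i ∈ A, j ∈ B} P i j`. -/
def weight (P : Matrix (Fin n) (Fin n) ℝ) (A B : Finset (Fin n)) : ℝ :=
  ∑ i ∈ A, ∑ j ∈ B, P i j

/-- The internal mass `(∑_{i, j ∈ S} P i j) / |S|`. -/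
def mass (P : Matrix (Fin n) (Fin n) ℝ) (S : Finset (Fin n)) : ℝ :=
  weight P S S / (S.card : ℝ)

/-- The expansion of `R ⊆ V` with respect to the submatrix of `P` with rows and columns in `V`. -/
def expansion (P : Matrix (Fin n) (Fin n) ℝ) (V R : Finset (Fin n)) : ℝ :=
  weight P R (V \ R) / (min R.card (V \ R).card : ℕ)

/-- The cut value of `S ⊆ V` with respect to the submatrix of `P` with rows and columns in `V`,
written with the cut metric. -/
def cutValue (P : Matrix (Fin n) (Fin n) ℝ) (V S : Finset (Fin n)) : ℝ :=
  (∑ i ∈ V, ∑ j ∈ V, cutMetric S i j * P i j) / (∑ i ∈ V, ∑ j ∈ V, cutMetric S i j)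

/-- Feasible points of the linear programming relaxation of the sparsest cut problem on the state
space `V` in which all states of `T` must lie in the same component: normalised (pseudo)metrics
on `V` that collapse `T` to a point. -/
structure IsFeasible (V T : Finset (Fin n)) (δ : Fin n → Fin n → ℝ) : Prop where
  self : ∀ i ∈ V, δ i i = 0
  symm : ∀ i ∈ V, ∀ j ∈ V, δ i j = δ j i
  triangle : ∀ i ∈ V, ∀ j ∈ V, ∀ k ∈ V, δ i j ≤ δ i k + δ k j
  sum_eq_one : ∑ i ∈ V, ∑ j ∈ V, δ i j = 1
  nonneg : ∀ i ∈ V, ∀ j ∈ V, 0 ≤ δ i j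
  zero_on : ∀ i ∈ T, ∀ j ∈ T, δ i j = 0
  const_on : ∀ i ∈ T, ∀ j ∈ T, ∀ k ∈ V, δ i k = δ j k

/-- The objective `∑_{i, j ∈ V} δ i j * P i j` of the linear program. -/
def objective (P : Matrix (Fin n) (Fin n) ℝ) (V : Finset (Fin n)) (δ : Fin n → Fin n → ℝ) : ℝ :=
  ∑ i ∈ V, ∑ j ∈ V, δ i j * P i j

/-- `δ` is an optimal solution of the linear program. -/
def IsOptimal (P : Matrix (Fin n) (Fin n) ℝ) (V T : Finset (Fin n))
    (δ : Fin n → Fin n → ℝ) : Prop :=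
  IsFeasible V T δ ∧ ∀ δ', IsFeasible V T δ' → objective P V δ ≤ objective P V δ'

/-- `f` embeds `(V, δ)` into `ℓ₁^m` without contraction and with expansion at most
`C log |V|`. -/
def IsEmbedding (C : ℝ) (V : Finset (Fin n)) (δ : Fin n → Fin n → ℝ) {m : ℕ}
    (f : Fin n → Fin m → ℝ) : Prop :=
  ∀ i ∈ V, ∀ j ∈ V, δ i j ≤ ∑ k, |f i k - f j k| ∧
    ∑ k, |f i k - f j k| ≤ C * Real.log V.card * δ i j

/-- The cuts `S ∈ 𝒞` of `V`, with the coefficients `a S > 0`, write the `ℓ₁` distance between the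
points `f i`, `i ∈ V`, as a positive combination of cut metrics. -/
def IsCutDecomposition (V : Finset (Fin n)) {m : ℕ} (f : Fin n → Fin m → ℝ)
    (𝒞 : Finset (Finset (Fin n))) (a : Finset (Fin n) → ℝ) : Prop :=
  (∀ S ∈ 𝒞, S.Nonempty ∧ S ⊂ V ∧ 0 < a S) ∧
    ∀ i ∈ V, ∀ j ∈ V, ∑ k, |f i k - f j k| = ∑ S ∈ 𝒞, a S * cutMetric S i j

/-- `FindComp C P V T S`: a run of the subroutine FindComp on the state space `V`, the submatrix
of `P` on `V` and the set of states `T` may return `S`. The run solves the linear program, embeds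
the solution into `ℓ₁` with distortion `C log |V|`, decomposes the `ℓ₁` metric into cuts,
takes a cut of least cut value among these, and returns a side of it that does not meet `T`. -/
def FindComp (C : ℝ) (P : Matrix (Fin n) (Fin n) ℝ) (V T S : Finset (Fin n)) : Prop :=
  ∃ δ : Fin n → Fin n → ℝ, IsOptimal P V T δ ∧
    ∃ (m : ℕ) (f : Fin n → Fin m → ℝ), IsEmbedding C V δ f ∧
      ∃ (𝒞 : Finset (Finset (Fin n))) (a : Finset (Fin n) → ℝ), IsCutDecomposition V f 𝒞 a ∧
        ∃ S₀ ∈ 𝒞, (∀ S₁ ∈ 𝒞, cutValue P V S₀ ≤ cutValue P V S₁) ∧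
          (S = S₀ ∨ S = V \ S₀) ∧ Disjoint S T

/-- The states of a run of Partition Graph. -/
inductive State (n : ℕ) : Type
  /-- The components in `𝒮`, with union `T`, have been extracted; Extract Component is about to be
  called with the set `T`. -/
  | outer (𝒮 : Finset (Finset (Fin n))) (T : Finset (Fin n)) : State n
  /-- As before, and the call of Extract Component is at the head of its while loop with the
  current set `S`. -/
  | inner (𝒮 : Finset (Finset (Fin n))) (T S : Finset (Fin n)) : State n
  /-- Partition Graph has returned the pair `(𝒮, T)`. -/
  | done (𝒮 : Finset (Finset (Fin n))) (T : Finset (Fin n)) : State n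

/-- One step of Partition Graph on input `(P, β)`, with the subroutine Extract Component run
in place. -/
inductive Step (C : ℝ) (P : Matrix (Fin n) (Fin n) ℝ) (β : ℝ) : State n → State n → Prop
  /-- No state is left: Extract Component returns False and Partition Graph stops. -/
  | exhausted (𝒮 : Finset (Finset (Fin n))) :
      Step C P β (.outer 𝒮 Finset.univ) (.done 𝒮 ∅)
  /-- FindComp returns a set of small expansion, with which the while loop is entered. -/
  | enterCut (𝒮 : Finset (Finset (Fin n))) (T S : Finset (Fin n)) :
      T ≠ Finset.univ → FindComp C P Finset.univ T S →
      expansion P Finset.univ S < β / 8 →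
      Step C P β (.outer 𝒮 T) (.inner 𝒮 T S)
  /-- FindComp finds no such set, but the set of all remaining states has large internal mass; the
  while loop is entered with it. -/
  | enterRest (𝒮 : Finset (Finset (Fin n))) (T S : Finset (Fin n)) :
      T ≠ Finset.univ → FindComp C P Finset.univ T S →
      β / 8 ≤ expansion P Finset.univ S →
      1 - β / 8 < mass P (Finset.univ \ T) →
      Step C P β (.outer 𝒮 T) (.inner 𝒮 T (Finset.univ \ T))
  /-- Neither is the case: Extract Component returns False and Partition Graph stops. -/
  | fail (𝒮 : Finset (Finset (Fin n))) (T S : Finset (Fin n)) :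
      T ≠ Finset.univ → FindComp C P Finset.univ T S →
      β / 8 ≤ expansion P Finset.univ S →
      mass P (Finset.univ \ T) ≤ 1 - β / 8 →
      Step C P β (.outer 𝒮 T) (.done 𝒮 (Finset.univ \ T))
  /-- The current set has at most one element: Extract Component returns it. -/
  | exitSmall (𝒮 : Finset (Finset (Fin n))) (T S : Finset (Fin n)) :
      S.card ≤ 1 →
      Step C P β (.inner 𝒮 T S) (.outer (insert S 𝒮) (T ∪ S))
  /-- No sparse cut is found inside the current set: Extract Component returns it. -/
  | exitBreak (𝒮 : Finset (Finset (Fin n))) (T S S' : Finset (Fin n)) :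
      1 < S.card → FindComp C P S ∅ S' →
      β / (8 * Real.log n) ≤ expansion P S S' →
      Step C P β (.inner 𝒮 T S) (.outer (insert S 𝒮) (T ∪ S))
  /-- A sparse cut is found inside the current set, and `S'` is its side of larger mass. -/
  | keepCut (𝒮 : Finset (Finset (Fin n))) (T S S' : Finset (Fin n)) :
      1 < S.card → FindComp C P S ∅ S' →
      expansion P S S' < β / (8 * Real.log n) →
      mass P (S \ S') ≤ mass P S' →
      Step C P β (.inner 𝒮 T S) (.inner 𝒮 T S')
  /-- A sparse cut is found inside the current set, and `S \ S'` is its side of larger mass. -/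
  | keepCompl (𝒮 : Finset (Finset (Fin n))) (T S S' : Finset (Fin n)) :
      1 < S.card → FindComp C P S ∅ S' →
      expansion P S S' < β / (8 * Real.log n) →
      mass P S' < mass P (S \ S') →
      Step C P β (.inner 𝒮 T S) (.inner 𝒮 T (S \ S'))

/-- The initial state: nothing has been extracted. -/
def start (n : ℕ) : State n := .outer ∅ ∅

/-- `s` occurs in some run of Partition Graph on input `(P, β)`. -/
def Reachable (C : ℝ) (P : Matrix (Fin n) (Fin n) ℝ) (β : ℝ) (s : State n) : Prop :=
  Relation.ReflTransGen (Step C P β) (start n) s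

/-- Some run of Partition Graph on input `(P, β)` returns `(𝒮, T)`. -/
def Returns (C : ℝ) (P : Matrix (Fin n) (Fin n) ℝ) (β : ℝ)
    (𝒮 : Finset (Finset (Fin n))) (T : Finset (Fin n)) : Prop :=
  Reachable C P β (.done 𝒮 T)

/-- Every run of Partition Graph on input `(P, β)` can be continued until it returns, and no run
is infinite. -/
def AlwaysReturns (C : ℝ) (P : Matrix (Fin n) (Fin n) ℝ) (β : ℝ) : Prop :=
  (∀ s, Reachable C P β s → (∃ 𝒮 T, s = State.done 𝒮 T) ∨ ∃ s', Step C P β s s') ∧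
    ¬ ∃ r : ℕ → State n, r 0 = start n ∧ ∀ k, Step C P β (r k) (r (k + 1))

/-- The sets in `𝒮` are nonempty and, together with the possibly empty set `T`, they
partition the state space. -/
def IsPartition (𝒮 : Finset (Finset (Fin n))) (T : Finset (Fin n)) : Prop :=
  (∀ S ∈ 𝒮, S.Nonempty) ∧
    (∀ S ∈ 𝒮, ∀ S' ∈ 𝒮, S ≠ S' → Disjoint S S') ∧
    (∀ S ∈ 𝒮, Disjoint S T) ∧
    𝒮.sup id ∪ T = Finset.univ

end PartitionGraph

end

noncomputable section

namespace PartitionGraph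

variable {n : ℕ}

/-- `d` is a pseudometric on `V`. -/
structure IsPseudometricOn (V : Finset (Fin n)) (d : Fin n → Fin n → ℝ) : Prop where
  self : ∀ i ∈ V, d i i = 0
  symm : ∀ i ∈ V, ∀ j ∈ V, d i j = d j i
  triangle : ∀ i ∈ V, ∀ j ∈ V, ∀ k ∈ V, d i j ≤ d i k + d k j

lemma IsPseudometricOn.nonneg {V : Finset (Fin n)} {d : Fin n → Fin n → ℝ}
    (hd : IsPseudometricOn V d) {i j : Fin n} (hi : i ∈ V) (hj : j ∈ V) : 0 ≤ d i j := by
  have h1 := hd.triangle i hi i hi j hj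
  rw [hd.self i hi, ← hd.symm i hi j hj] at h1
  linarith

/-- The distance from `x` to the set `A`, which is `0` if `A` is empty. -/
def distTo (d : Fin n → Fin n → ℝ) (A : Finset (Fin n)) (x : Fin n) : ℝ :=
  if h : A.Nonempty then A.inf' h (d x) else 0

lemma distTo_le {d : Fin n → Fin n → ℝ} {A : Finset (Fin n)} {x z : Fin n} (hz : z ∈ A) :
    distTo d A x ≤ d x z := by
  rw [distTo, dif_pos ⟨z, hz⟩]
  exact Finset.inf'_le _ hz

lemma le_distTo {d : Fin n → Fin n → ℝ} {A : Finset (Fin n)} {x : Fin n} {r : ℝ}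
    (hA : A.Nonempty) (h : ∀ z ∈ A, r ≤ d x z) : r ≤ distTo d A x := by
  rw [distTo, dif_pos hA]
  exact Finset.le_inf' _ _ h

lemma distTo_le_add {V A : Finset (Fin n)} {d : Fin n → Fin n → ℝ}
    (hd : IsPseudometricOn V d) (hA : A ⊆ V) {x y : Fin n} (hx : x ∈ V) (hy : y ∈ V) :
    distTo d A x ≤ d x y + distTo d A y := by
  by_cases h : A.Nonempty
  · have : distTo d A x - d x y ≤ distTo d A y := by
      refine le_distTo h fun z hz => ?_
      have h1 := distTo_le (d := d) (x := x) hz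
      have h2 := hd.triangle x hx z (hA hz) y hy
      linarith
    linarith
  · simp only [distTo, dif_neg h, add_zero]
    exact hd.nonneg hx hy

lemma abs_distTo_sub_le {V A : Finset (Fin n)} {d : Fin n → Fin n → ℝ}
    (hd : IsPseudometricOn V d) (hA : A ⊆ V) {x y : Fin n} (hx : x ∈ V) (hy : y ∈ V) :
    |distTo d A x - distTo d A y| ≤ d x y := by
  have h1 := distTo_le_add hd hA hx hy
  have h2 := distTo_le_add hd hA hy hx
  rw [hd.symm y hy x hx] at h2
  rw [abs_le]
  constructor <;> linarith

/-- The probability that a random subset of `V`, which contains each point independently with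
probability `p`, is equal to `A`. -/
def coinWeight (V : Finset (Fin n)) (p : ℝ) (A : Finset (Fin n)) : ℝ :=
  p ^ A.card * (1 - p) ^ (V.card - A.card)

lemma coinWeight_nonneg (V A : Finset (Fin n)) {p : ℝ} (h0 : 0 ≤ p) (h1 : p ≤ 1) :
    0 ≤ coinWeight V p A :=
  mul_nonneg (pow_nonneg h0 _) (pow_nonneg (by linarith) _)

lemma sum_coinWeight_disjoint {V B : Finset (Fin n)} (hB : B ⊆ V) (p : ℝ) :
    ∑ A ∈ V.powerset with Disjoint A B, coinWeight V p A = (1 - p) ^ B.card := by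
  have h1 : (V.powerset.filter fun A => Disjoint A B) = (V \ B).powerset := by
    ext A
    simp [Finset.subset_sdiff]
  have h2 : ∀ A ∈ (V \ B).powerset, coinWeight V p A
      = (1 - p) ^ B.card * (p ^ A.card * (1 - p) ^ ((V \ B).card - A.card)) := by
    intro A hA
    have h3 := Finset.card_le_card (Finset.mem_powerset.1 hA)
    have h4 := Finset.card_sdiff_add_card_eq_card hB
    have h5 : V.card - A.card = B.card + ((V \ B).card - A.card) := by omega
    rw [coinWeight, h5, pow_add]
    ring
  rw [h1, Finset.sum_congr rfl h2, ← Finset.mul_sum, Finset.sum_pow_mul_eq_add_pow]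
  simp

lemma sum_coinWeight (V : Finset (Fin n)) (p : ℝ) :
    ∑ A ∈ V.powerset, coinWeight V p A = 1 := by
  have := sum_coinWeight_disjoint (Finset.empty_subset V) p
  simpa using this

lemma sum_coinWeight_hit_miss {V B G : Finset (Fin n)} (hB : B ⊆ V) (hG : G ⊆ V)
    (hBG : Disjoint B G) (p : ℝ) :
    ∑ A ∈ V.powerset with Disjoint A B ∧ ¬ Disjoint A G, coinWeight V p A
      = (1 - p) ^ B.card * (1 - (1 - p) ^ G.card) := by
  have h1 := sum_coinWeight_disjoint hB p
  have h2 := sum_coinWeight_disjoint (Finset.union_subset hB hG) p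
  have h3 := Finset.sum_filter_add_sum_filter_not (V.powerset.filter fun A => Disjoint A B)
    (fun A => Disjoint A G) (coinWeight V p)
  rw [Finset.filter_filter, Finset.filter_filter, h1] at h3
  simp only [Finset.disjoint_union_right] at h2
  rw [h2, Finset.card_union_of_disjoint hBG, pow_add] at h3
  linarith

lemma hit_miss_prob_ge (t b g : ℕ) (hb : b ≤ 2 ^ (t + 1)) (hg : 2 ^ t ≤ g) :
    (1 / 12 : ℝ) ≤ (1 - (1 / 2) ^ (t + 1)) ^ b * (1 - (1 - (1 / 2) ^ (t + 1)) ^ g) := by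
  set p : ℝ := (1 / 2) ^ (t + 1) with hp
  have hp0 : 0 < p := by positivity
  have hp1 : p ≤ 1 := pow_le_one₀ (by norm_num) (by norm_num)
  have hpt : (2 : ℝ) ^ t * p = 1 / 2 := by
    rw [hp, pow_succ, ← mul_assoc, ← mul_pow]
    norm_num
  set q : ℝ := (1 - p) ^ 2 ^ t with hq
  have hq1 : 1 / 2 ≤ q := by
    have := one_add_mul_le_pow (a := -p) (by linarith) (2 ^ t)
    push_cast at this
    rw [← sub_eq_add_neg] at this
    linarith
  have hq2 : q ≤ 2 / 3 := by
    have h1 := one_add_mul_le_pow (a := p) (by linarith) (2 ^ t)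
    push_cast at h1
    rw [hpt] at h1
    have h2 : q * (1 + p) ^ 2 ^ t ≤ 1 := by
      rw [hq, ← mul_pow]
      exact pow_le_one₀ (mul_nonneg (by linarith) (by linarith)) (by nlinarith)
    nlinarith
  have h1 : q ^ 2 ≤ (1 - p) ^ b := by
    rw [hq, ← pow_mul, ← pow_succ]
    exact pow_le_pow_of_le_one (by linarith) (by linarith) hb
  have h2 : (1 - p) ^ g ≤ q := pow_le_pow_of_le_one (by linarith) (by linarith) hg
  have h3 : (1 : ℝ) / 4 ≤ (1 - p) ^ b := by nlinarith
  nlinarith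

/-- If the open `s`-ball at `x` is small and the closed `r`-ball at `y` is large, then a random
set of the corresponding density separates `x` and `y`. -/
lemma separation_of_balls {V : Finset (Fin n)} {d : Fin n → Fin n → ℝ}
    (hd : IsPseudometricOn V d) {x y : Fin n} (hx : x ∈ V) (hy : y ∈ V) {r s : ℝ} {t : ℕ}
    (hrs : r ≤ s) (hsum : r + s ≤ d x y)
    (hsmall : (V.filter fun z => d x z < s).card < 2 ^ (t + 1))
    (hlarge : 2 ^ t ≤ (V.filter fun z => d y z ≤ r).card) :
    1 / 12 * (s - r) ≤ ∑ A ∈ V.powerset, coinWeight V ((1 / 2) ^ (t + 1)) A *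
      |distTo d A x - distTo d A y| := by
  set B := V.filter fun z => d x z < s
  set G := V.filter fun z => d y z ≤ r
  have hdisj : Disjoint B G := by
    rw [Finset.disjoint_left]
    intro z hzB hzG
    simp only [B, G, Finset.mem_filter] at hzB hzG
    have h1 := hd.triangle x hx y hy z hzB.1
    rw [hd.symm z hzB.1 y hy] at h1
    linarith
  have hp := hit_miss_prob_ge t B.card G.card hsmall.le hlarge
  rw [← sum_coinWeight_hit_miss (Finset.filter_subset _ _) (Finset.filter_subset _ _) hdisj] at hp
  have hw : ∀ A, 0 ≤ coinWeight V ((1 / 2) ^ (t + 1)) A := fun A =>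
    coinWeight_nonneg V A (by positivity) (pow_le_one₀ (by norm_num) (by norm_num))
  calc 1 / 12 * (s - r)
      ≤ (∑ A ∈ V.powerset with Disjoint A B ∧ ¬ Disjoint A G,
          coinWeight V ((1 / 2) ^ (t + 1)) A) * (s - r) :=
        mul_le_mul_of_nonneg_right hp (by linarith)
    _ = ∑ A ∈ V.powerset with Disjoint A B ∧ ¬ Disjoint A G,
          coinWeight V ((1 / 2) ^ (t + 1)) A * (s - r) := Finset.sum_mul _ _ _
    _ ≤ ∑ A ∈ V.powerset with Disjoint A B ∧ ¬ Disjoint A G,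
          coinWeight V ((1 / 2) ^ (t + 1)) A * |distTo d A x - distTo d A y| := by
        refine Finset.sum_le_sum fun A hA => mul_le_mul_of_nonneg_left ?_ (hw A)
        rw [Finset.mem_filter, Finset.mem_powerset] at hA
        obtain ⟨hAV, hAB, hAG⟩ := hA
        obtain ⟨z, hzA, hzG⟩ := Finset.not_disjoint_iff.1 hAG
        have h1 : distTo d A y ≤ r :=
          (distTo_le hzA).trans (Finset.mem_filter.1 hzG).2
        have h2 : s ≤ distTo d A x := by
          refine le_distTo ⟨z, hzA⟩ fun u hu => ?_
          by_contra hlt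
          exact Finset.disjoint_left.1 hAB hu
            (Finset.mem_filter.2 ⟨hAV hu, not_le.1 hlt⟩)
        exact (by linarith : s - r ≤ distTo d A x - distTo d A y).trans (le_abs_self _)
    _ ≤ _ := Finset.sum_le_sum_of_subset_of_nonneg (Finset.filter_subset _ _)
        fun A _ _ => mul_nonneg (hw A) (abs_nonneg _)

/-- The distances at which both closed balls at `x` and `y` have at least `2 ^ t` points,
together with half the distance of `x` and `y`. -/
def radiusCandidates (V : Finset (Fin n)) (d : Fin n → Fin n → ℝ) (x y : Fin n) (t : ℕ) :
    Finset ℝ :=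
  insert (d x y / 2) ((V.image (d x) ∪ V.image (d y)).filter fun r =>
    2 ^ t ≤ (V.filter fun z => d x z ≤ r).card ∧ 2 ^ t ≤ (V.filter fun z => d y z ≤ r).card)

/-- The smallest radius, at most half the distance of `x` and `y`, at which both closed balls at
`x` and `y` have at least `2 ^ t` points. -/
def radius (V : Finset (Fin n)) (d : Fin n → Fin n → ℝ) (x y : Fin n) (t : ℕ) : ℝ :=
  (radiusCandidates V d x y t).min' (Finset.insert_nonempty _ _)

lemma radius_le_half (V : Finset (Fin n)) (d : Fin n → Fin n → ℝ) (x y : Fin n) (t : ℕ) :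
    radius V d x y t ≤ d x y / 2 :=
  Finset.min'_le _ _ (Finset.mem_insert_self _ _)

lemma radius_le_succ (V : Finset (Fin n)) (d : Fin n → Fin n → ℝ) (x y : Fin n) (t : ℕ) :
    radius V d x y t ≤ radius V d x y (t + 1) := by
  refine Finset.min'_subset _ (Finset.insert_subset_insert _ ?_)
  intro r hr
  rw [Finset.mem_filter] at hr ⊢
  have : 2 ^ t ≤ 2 ^ (t + 1) := Nat.pow_le_pow_right (by norm_num) (Nat.le_succ t)
  exact ⟨hr.1, this.trans hr.2.1, this.trans hr.2.2⟩

lemma radius_zero_le {V : Finset (Fin n)} {d : Fin n → Fin n → ℝ}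
    (hd : IsPseudometricOn V d) {x y : Fin n} (hx : x ∈ V) (hy : y ∈ V) :
    radius V d x y 0 ≤ 0 := by
  refine Finset.min'_le _ _ (Finset.mem_insert_of_mem ?_)
  rw [Finset.mem_filter]
  refine ⟨Finset.mem_union_left _ (Finset.mem_image.2 ⟨x, hx, hd.self x hx⟩), ?_, ?_⟩
  · exact Finset.card_pos.2 ⟨x, Finset.mem_filter.2 ⟨hx, (hd.self x hx).le⟩⟩
  · exact Finset.card_pos.2 ⟨y, Finset.mem_filter.2 ⟨hy, (hd.self y hy).le⟩⟩

lemma radius_eq_half {V : Finset (Fin n)} (d : Fin n → Fin n → ℝ) (x y : Fin n) {t : ℕ}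
    (ht : V.card < 2 ^ t) : radius V d x y t = d x y / 2 := by
  have h := Finset.min'_mem (radiusCandidates V d x y t) (Finset.insert_nonempty _ _)
  rcases Finset.mem_insert.1 h with h | h
  · exact h
  · have h1 := (Finset.mem_filter.1 h).2.1
    have h2 := Finset.card_filter_le V fun z => d x z ≤ radius V d x y t
    exact absurd (h1.trans h2) (not_le.2 ht)

lemma large_of_radius_lt {V : Finset (Fin n)} {d : Fin n → Fin n → ℝ} {x y : Fin n} {t : ℕ}
    (h : radius V d x y t < d x y / 2) :
    2 ^ t ≤ (V.filter fun z => d x z ≤ radius V d x y t).card ∧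
      2 ^ t ≤ (V.filter fun z => d y z ≤ radius V d x y t).card := by
  have h' := Finset.min'_mem (radiusCandidates V d x y t) (Finset.insert_nonempty _ _)
  rcases Finset.mem_insert.1 h' with h' | h'
  · exact absurd h' h.ne
  · exact (Finset.mem_filter.1 h').2

lemma small_at_radius (V : Finset (Fin n)) (d : Fin n → Fin n → ℝ) (x y : Fin n) (t : ℕ) :
    (V.filter fun z => d x z < radius V d x y t).card < 2 ^ t ∨
      (V.filter fun z => d y z < radius V d x y t).card < 2 ^ t := by
  by_contra! hcon
  obtain ⟨hX, hY⟩ := hcon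
  set ρ := radius V d x y t with hρ
  set X := V.filter fun z => d x z < ρ
  set Y := V.filter fun z => d y z < ρ
  set E := X.image (d x) ∪ Y.image (d y) with hE
  have hXne : X.Nonempty := Finset.card_pos.1 (lt_of_lt_of_le (by positivity) hX)
  have hEne : E.Nonempty := (hXne.image _).mono Finset.subset_union_left
  have hmem := E.max'_mem hEne
  set r := E.max' hEne with hr
  have hrlt : r < ρ := by
    rcases Finset.mem_union.1 hmem with h | h <;>
    · obtain ⟨z, hz, hzr⟩ := Finset.mem_image.1 h
      rw [← hzr]
      exact (Finset.mem_filter.1 hz).2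
  have hle : ρ ≤ r := by
    refine Finset.min'_le _ _ (Finset.mem_insert_of_mem (Finset.mem_filter.2 ⟨?_, ?_, ?_⟩))
    · exact Finset.union_subset_union (Finset.image_subset_image (Finset.filter_subset _ _))
        (Finset.image_subset_image (Finset.filter_subset _ _)) hmem
    · refine hX.trans (Finset.card_le_card fun z hz => Finset.mem_filter.2
        ⟨(Finset.mem_filter.1 hz).1, Finset.le_max' _ _ ?_⟩)
      exact Finset.mem_union_left _ (Finset.mem_image_of_mem _ hz)
    · refine hY.trans (Finset.card_le_card fun z hz => Finset.mem_filter.2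
        ⟨(Finset.mem_filter.1 hz).1, Finset.le_max' _ _ ?_⟩)
      exact Finset.mem_union_right _ (Finset.mem_image_of_mem _ hz)
  exact absurd hle (not_le.2 hrlt)

lemma separation_step {V : Finset (Fin n)} {d : Fin n → Fin n → ℝ}
    (hd : IsPseudometricOn V d) {x y : Fin n} (hx : x ∈ V) (hy : y ∈ V) (t : ℕ) :
    1 / 12 * (radius V d x y (t + 1) - radius V d x y t) ≤
      ∑ A ∈ V.powerset, coinWeight V ((1 / 2) ^ (t + 1)) A *
        |distTo d A x - distTo d A y| := by
  have hle := radius_le_succ V d x y t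
  have hhalf := radius_le_half V d x y (t + 1)
  rcases hle.eq_or_lt with heq | hlt
  · rw [heq, sub_self, mul_zero]
    exact Finset.sum_nonneg fun A _ => mul_nonneg
      (coinWeight_nonneg V A (by positivity) (pow_le_one₀ (by norm_num) (by norm_num)))
      (abs_nonneg _)
  · obtain ⟨hX, hY⟩ := large_of_radius_lt (hlt.trans_le hhalf)
    rcases small_at_radius V d x y (t + 1) with hs | hs
    · exact separation_of_balls hd hx hy hle (by linarith) hs hY
    · have := separation_of_balls hd hy hx hle (by rw [hd.symm y hy x hx]; linarith) hs hX
      simpa only [abs_sub_comm] using this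

/-- The average over random sets `A`, of densities `1/2, 1/4, …, 1/2 ^ L`, of the line metrics
given by the distance to `A`. -/
def randomSetMetric (V : Finset (Fin n)) (d : Fin n → Fin n → ℝ) (L : ℕ) (x y : Fin n) : ℝ :=
  ∑ t ∈ Finset.range L, ∑ A ∈ V.powerset, coinWeight V ((1 / 2) ^ (t + 1)) A *
    |distTo d A x - distTo d A y|

lemma le_randomSetMetric {V : Finset (Fin n)} {d : Fin n → Fin n → ℝ}
    (hd : IsPseudometricOn V d) {x y : Fin n} (hx : x ∈ V) (hy : y ∈ V) {L : ℕ}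
    (hL : V.card < 2 ^ L) : d x y ≤ 24 * randomSetMetric V d L x y := by
  have h1 := Finset.sum_le_sum fun t (_ : t ∈ Finset.range L) => separation_step hd hx hy t
  rw [← Finset.mul_sum, Finset.sum_range_sub (radius V d x y), radius_eq_half d x y hL] at h1
  have h2 := radius_zero_le hd hx hy
  rw [randomSetMetric]
  linarith

lemma randomSetMetric_le {V : Finset (Fin n)} {d : Fin n → Fin n → ℝ}
    (hd : IsPseudometricOn V d) {x y : Fin n} (hx : x ∈ V) (hy : y ∈ V) (L : ℕ) :
    randomSetMetric V d L x y ≤ L * d x y := by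
  have h : ∀ t ∈ Finset.range L, ∑ A ∈ V.powerset, coinWeight V ((1 / 2) ^ (t + 1)) A *
      |distTo d A x - distTo d A y| ≤ d x y := by
    intro t _
    calc _ ≤ ∑ A ∈ V.powerset, coinWeight V ((1 / 2) ^ (t + 1)) A * d x y :=
          Finset.sum_le_sum fun A hA => mul_le_mul_of_nonneg_left
            (abs_distTo_sub_le hd (Finset.mem_powerset.1 hA) hx hy)
            (coinWeight_nonneg V A (by positivity) (pow_le_one₀ (by norm_num) (by norm_num)))
      _ = d x y := by rw [← Finset.sum_mul, sum_coinWeight, one_mul]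
  simpa [randomSetMetric] using Finset.sum_le_sum h

lemma natLog_succ_le {N : ℕ} (hN : 2 ≤ N) : ((Nat.log 2 N + 1 : ℕ) : ℝ) ≤ 3 * Real.log N := by
  have h1 : (Nat.log 2 N : ℝ) * Real.log 2 ≤ Real.log N := by
    rw [← Real.log_pow]
    refine Real.log_le_log (by positivity) ?_
    exact_mod_cast Nat.pow_log_le_self 2 (by omega)
  have h2 : (1 : ℝ) ≤ Nat.log 2 N := by
    exact_mod_cast Nat.log_pos (by norm_num) hN
  have h3 := Real.log_two_gt_d9
  push_cast
  nlinarith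

/-- `D` agrees on `V` with a nonnegative combination of cut metrics. -/
def InCutCone (V : Finset (Fin n)) (D : Fin n → Fin n → ℝ) : Prop :=
  ∃ a : Finset (Fin n) → ℝ, (∀ S, 0 ≤ a S) ∧
    ∀ i ∈ V, ∀ j ∈ V, D i j = ∑ S ∈ V.powerset, a S * cutMetric S i j

lemma InCutCone.zero (V : Finset (Fin n)) : InCutCone V fun _ _ => 0 :=
  ⟨fun _ => 0, fun _ => le_rfl, by simp⟩

lemma InCutCone.add {V : Finset (Fin n)} {D E : Fin n → Fin n → ℝ} (hD : InCutCone V D)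
    (hE : InCutCone V E) : InCutCone V fun i j => D i j + E i j := by
  obtain ⟨a, ha, hDa⟩ := hD
  obtain ⟨b, hb, hEb⟩ := hE
  refine ⟨fun S => a S + b S, fun S => add_nonneg (ha S) (hb S), fun i hi j hj => ?_⟩
  simp only [hDa i hi j hj, hEb i hi j hj, add_mul, Finset.sum_add_distrib]

lemma InCutCone.smul {V : Finset (Fin n)} {D : Fin n → Fin n → ℝ} (hD : InCutCone V D)
    {w : ℝ} (hw : 0 ≤ w) : InCutCone V fun i j => w * D i j := by
  obtain ⟨a, ha, hDa⟩ := hD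
  refine ⟨fun S => w * a S, fun S => mul_nonneg hw (ha S), fun i hi j hj => ?_⟩
  simp only [hDa i hi j hj, mul_assoc, Finset.mul_sum]

lemma InCutCone.sum {ι : Type*} {V : Finset (Fin n)} (s : Finset ι)
    {D : ι → Fin n → Fin n → ℝ} (hD : ∀ k ∈ s, InCutCone V (D k)) :
    InCutCone V fun i j => ∑ k ∈ s, D k i j := by
  classical
  induction s using Finset.induction_on with
  | empty => simpa using InCutCone.zero V
  | insert k s hk ih =>
    have h1 := (hD k (Finset.mem_insert_self k s)).add
      (ih fun l hl => hD l (Finset.mem_insert_of_mem hl))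
    simpa only [Finset.sum_insert hk] using h1

lemma InCutCone.congr {V : Finset (Fin n)} {D E : Fin n → Fin n → ℝ} (hD : InCutCone V D)
    (h : ∀ i ∈ V, ∀ j ∈ V, E i j = D i j) : InCutCone V E := by
  obtain ⟨a, ha, hDa⟩ := hD
  exact ⟨a, ha, fun i hi j hj => (h i hi j hj).trans (hDa i hi j hj)⟩

lemma InCutCone.cutMetric {V S : Finset (Fin n)} (hS : S ⊆ V) : InCutCone V (cutMetric S) := by
  refine ⟨fun R => if R = S then 1 else 0, fun R => by positivity, fun i _ j _ => ?_⟩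
  simp [Finset.sum_ite_eq', hS]

lemma InCutCone.abs_sub (V : Finset (Fin n)) (g : Fin n → ℝ) :
    InCutCone V fun i j => |g i - g j| := by
  induction hk : (V.image g).card using Nat.strong_induction_on generalizing g with
  | _ k ih =>
    by_cases hcard : (V.image g).card ≤ 1
    · refine (InCutCone.zero V).congr fun i hi j hj => ?_
      have := Finset.card_le_one.1 hcard (g i) (Finset.mem_image_of_mem g hi) (g j)
        (Finset.mem_image_of_mem g hj)
      simp [this]
    · have hne : (V.image g).Nonempty := Finset.card_pos.1 (by omega)
      set M := (V.image g).max' hne with hM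
      have hMmem : M ∈ V.image g := Finset.max'_mem _ _
      have hne' : ((V.image g).erase M).Nonempty := by
        apply Finset.card_pos.1
        rw [Finset.card_erase_of_mem hMmem]
        omega
      set M' := ((V.image g).erase M).max' hne' with hM'
      have hM'mem : M' ∈ (V.image g).erase M := Finset.max'_mem _ _
      have hM'M : M' ≤ M := Finset.le_max' _ _ (Finset.mem_of_mem_erase hM'mem)
      have hle : ∀ i ∈ V, g i ≠ M → g i ≤ M' := fun i hi h =>
        Finset.le_max' _ _ (Finset.mem_erase.2 ⟨h, Finset.mem_image_of_mem g hi⟩)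
      have himage : V.image (fun i => min (g i) M') ⊆ (V.image g).erase M := by
        intro v hv
        obtain ⟨i, hi, rfl⟩ := Finset.mem_image.1 hv
        by_cases h : g i = M
        · simpa only [h, min_eq_right hM'M] using hM'mem
        · simp only [min_eq_left (hle i hi h)]
          exact Finset.mem_erase.2 ⟨h, Finset.mem_image_of_mem g hi⟩
      have hlt := Finset.card_le_card himage
      rw [Finset.card_erase_of_mem hMmem] at hlt
      have h1 := ih _ (by omega) (fun i => min (g i) M') rfl
      have h2 : InCutCone V fun i j =>
          (M - M') * PartitionGraph.cutMetric (V.filter fun z => g z = M) i j :=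
        (InCutCone.cutMetric (Finset.filter_subset _ _)).smul (by linarith)
      refine (h1.add h2).congr fun i hi j hj => ?_
      simp only [PartitionGraph.cutMetric, Finset.mem_filter, hi, hj, true_and]
      by_cases h3 : g i = M <;> by_cases h4 : g j = M
      · simp [h3, h4]
      · have := hle j hj h4
        simp only [h3, h4, min_eq_right hM'M, min_eq_left this, iff_false, not_true, if_false]
        rw [abs_of_nonneg (by linarith), abs_of_nonneg (by linarith)]
        ring
      · have := hle i hi h3
        simp only [h3, h4, min_eq_right hM'M, min_eq_left this, iff_true, if_false]
        rw [abs_of_nonpos (by linarith), abs_of_nonpos (by linarith)]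
        ring
      · simp [h3, h4, min_eq_left (hle i hi h3), min_eq_left (hle j hj h4)]

lemma InCutCone.randomSetMetric (V : Finset (Fin n)) (d : Fin n → Fin n → ℝ) (L : ℕ) :
    InCutCone V (randomSetMetric V d L) := by
  refine InCutCone.sum _ fun t _ => InCutCone.sum _ fun A _ => ?_
  exact (InCutCone.abs_sub V (distTo d A)).smul
    (coinWeight_nonneg V A (by positivity) (pow_le_one₀ (by norm_num) (by norm_num)))

/-- **Bourgain's embedding theorem**: a finite pseudometric space embeds into `ℓ₁`, that is, into
the cone of cut metrics, with logarithmic distortion. -/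
theorem exists_cutCone_embedding {V : Finset (Fin n)} (hV : 2 ≤ V.card)
    {d : Fin n → Fin n → ℝ} (hd : IsPseudometricOn V d) :
    ∃ D, InCutCone V D ∧ ∀ i ∈ V, ∀ j ∈ V,
      d i j ≤ D i j ∧ D i j ≤ 72 * Real.log V.card * d i j := by
  set L := Nat.log 2 V.card + 1
  refine ⟨fun i j => 24 * randomSetMetric V d L i j,
    (InCutCone.randomSetMetric V d L).smul (by norm_num), fun i hi j hj => ⟨?_, ?_⟩⟩
  · exact le_randomSetMetric hd hi hj (Nat.lt_pow_succ_log_self (by norm_num) _)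
  · have h1 := randomSetMetric_le hd hi hj L
    have h2 := mul_le_mul_of_nonneg_right (natLog_succ_le hV) (hd.nonneg hi hj)
    linarith

lemma cutMetric_nonneg (S : Finset (Fin n)) (i j : Fin n) : 0 ≤ cutMetric S i j := by
  unfold cutMetric
  split_ifs <;> norm_num

lemma cutMetric_isPseudometricOn (V S : Finset (Fin n)) : IsPseudometricOn V (cutMetric S) where
  self i _ := by simp [cutMetric]
  symm i _ j _ := by simp only [cutMetric, iff_comm]
  triangle i _ j _ k _ := by
    by_cases hi : i ∈ S <;> by_cases hj : j ∈ S <;> by_cases hk : k ∈ S <;>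
      simp [cutMetric, hi, hj, hk]

lemma sum_cutMetric_mul {V S : Finset (Fin n)} (hS : S ⊆ V) (F : Fin n → Fin n → ℝ) :
    ∑ i ∈ V, ∑ j ∈ V, cutMetric S i j * F i j
      = ∑ i ∈ S, ∑ j ∈ V \ S, F i j + ∑ i ∈ V \ S, ∑ j ∈ S, F i j := by
  rw [← Finset.sum_sdiff hS, add_comm]
  congr 1
  · refine Finset.sum_congr rfl fun i hi => ?_
    rw [← Finset.sum_sdiff hS]
    have h1 : ∀ j ∈ S, cutMetric S i j * F i j = 0 := fun j hj => by simp [cutMetric, hi, hj]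
    rw [Finset.sum_eq_zero h1, add_zero]
    refine Finset.sum_congr rfl fun j hj => ?_
    simp [cutMetric, hi, (Finset.mem_sdiff.1 hj).2]
  · refine Finset.sum_congr rfl fun i hi => ?_
    have hi' := (Finset.mem_sdiff.1 hi).2
    rw [← Finset.sum_sdiff hS]
    have h1 : ∀ j ∈ V \ S, cutMetric S i j * F i j = 0 := fun j hj => by
      simp [cutMetric, hi', (Finset.mem_sdiff.1 hj).2]
    rw [Finset.sum_eq_zero h1, zero_add]
    refine Finset.sum_congr rfl fun j hj => ?_
    simp [cutMetric, hi', hj]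

lemma weight_comm {P : Matrix (Fin n) (Fin n) ℝ} (hP : P.IsSymm) (A B : Finset (Fin n)) :
    weight P A B = weight P B A := by
  refine Finset.sum_comm.trans ?_
  exact Finset.sum_congr rfl fun i _ => Finset.sum_congr rfl fun j _ => hP.apply i j

lemma weight_nonneg {P : Matrix (Fin n) (Fin n) ℝ} (h0 : ∀ i j, 0 ≤ P i j)
    (A B : Finset (Fin n)) : 0 ≤ weight P A B :=
  Finset.sum_nonneg fun i _ => Finset.sum_nonneg fun j _ => h0 i j

lemma sum_cutMetric_mul_eq_weight {P : Matrix (Fin n) (Fin n) ℝ} (hP : P.IsSymm)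
    {V S : Finset (Fin n)} (hS : S ⊆ V) :
    ∑ i ∈ V, ∑ j ∈ V, cutMetric S i j * P i j = 2 * weight P S (V \ S) := by
  rw [two_mul]
  refine (sum_cutMetric_mul hS P).trans ?_
  exact congrArg₂ _ rfl (weight_comm hP (V \ S) S)

lemma sum_cutMetric {V S : Finset (Fin n)} (hS : S ⊆ V) :
    ∑ i ∈ V, ∑ j ∈ V, cutMetric S i j = 2 * ((S.card : ℝ) * (V \ S).card) := by
  have h := sum_cutMetric_mul hS fun _ _ => 1
  simp only [mul_one, Finset.sum_const, nsmul_eq_mul] at h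
  rw [h]
  ring

lemma sum_cutMetric_pos {V S : Finset (Fin n)} (hne : S.Nonempty) (hS : S ⊂ V) :
    0 < ∑ i ∈ V, ∑ j ∈ V, cutMetric S i j := by
  rw [sum_cutMetric hS.subset]
  have h1 : 0 < S.card := hne.card_pos
  have h2 : 0 < (V \ S).card := (Finset.sdiff_nonempty.2 hS.not_subset).card_pos
  positivity

lemma cutValue_eq {P : Matrix (Fin n) (Fin n) ℝ} (hP : P.IsSymm) {V S : Finset (Fin n)}
    (hS : S ⊆ V) :
    cutValue P V S = weight P S (V \ S) / ((S.card : ℝ) * (V \ S).card) := by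
  rw [cutValue, sum_cutMetric_mul_eq_weight hP hS, sum_cutMetric hS,
    mul_div_mul_left _ _ two_ne_zero]

lemma expansion_sdiff {P : Matrix (Fin n) (Fin n) ℝ} (hP : P.IsSymm) {V S : Finset (Fin n)}
    (hS : S ⊆ V) : expansion P V (V \ S) = expansion P V S := by
  rw [expansion, expansion, Finset.sdiff_sdiff_eq_self hS, weight_comm hP, min_comm]

lemma expansion_eq_cutValue_mul_max {P : Matrix (Fin n) (Fin n) ℝ} (hP : P.IsSymm)
    {V S : Finset (Fin n)} (hne : S.Nonempty) (hS : S ⊂ V) :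
    expansion P V S = cutValue P V S * (max S.card (V \ S).card : ℕ) := by
  have h1 : 0 < S.card := hne.card_pos
  have h2 : 0 < (V \ S).card := (Finset.sdiff_nonempty.2 hS.not_subset).card_pos
  rw [expansion, cutValue_eq hP hS.subset, ← Nat.cast_mul,
    ← min_mul_max S.card (V \ S).card, Nat.cast_mul]
  have h3 : ((min S.card (V \ S).card : ℕ) : ℝ) ≠ 0 := by
    exact_mod_cast (lt_min h1 h2).ne'
  have h4 : ((max S.card (V \ S).card : ℕ) : ℝ) ≠ 0 := by
    exact_mod_cast (lt_max_of_lt_left h1).ne'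
  field_simp

lemma cutValue_nonneg {P : Matrix (Fin n) (Fin n) ℝ} (h0 : ∀ i j, 0 ≤ P i j)
    (V S : Finset (Fin n)) : 0 ≤ cutValue P V S :=
  div_nonneg
    (Finset.sum_nonneg fun i _ => Finset.sum_nonneg fun j _ =>
      mul_nonneg (cutMetric_nonneg S i j) (h0 i j))
    (Finset.sum_nonneg fun i _ => Finset.sum_nonneg fun j _ => cutMetric_nonneg S i j)

lemma expansion_le_cutValue {P : Matrix (Fin n) (Fin n) ℝ} (hP : P.IsSymm)
    (h0 : ∀ i j, 0 ≤ P i j) {V S : Finset (Fin n)} (hne : S.Nonempty) (hS : S ⊂ V) :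
    expansion P V S ≤ cutValue P V S * V.card := by
  rw [expansion_eq_cutValue_mul_max hP hne hS]
  refine mul_le_mul_of_nonneg_left ?_ (cutValue_nonneg h0 V S)
  exact_mod_cast max_le (Finset.card_le_card hS.subset)
    (Finset.card_le_card Finset.sdiff_subset)

lemma cutValue_le_expansion {P : Matrix (Fin n) (Fin n) ℝ} (hP : P.IsSymm)
    (h0 : ∀ i j, 0 ≤ P i j) {V S : Finset (Fin n)} (hne : S.Nonempty) (hS : S ⊂ V) :
    cutValue P V S * V.card ≤ 2 * expansion P V S := by
  rw [expansion_eq_cutValue_mul_max hP hne hS, mul_left_comm]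
  refine mul_le_mul_of_nonneg_left ?_ (cutValue_nonneg h0 V S)
  have h1 := Finset.card_sdiff_add_card_eq_card hS.subset
  have h2 : V.card ≤ 2 * max S.card (V \ S).card := by omega
  exact_mod_cast h2

/-- A pseudometric on `V` that vanishes on `T` and has positive total can be normalised to a
feasible point of the linear program. -/
lemma IsPseudometricOn.isFeasible_div {V T : Finset (Fin n)} {d : Fin n → Fin n → ℝ}
    (hd : IsPseudometricOn V d) (hTV : T ⊆ V) (hT : ∀ i ∈ T, ∀ j ∈ T, d i j = 0)
    (hpos : 0 < ∑ i ∈ V, ∑ j ∈ V, d i j) :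
    IsFeasible V T fun i j => d i j / ∑ i ∈ V, ∑ j ∈ V, d i j where
  self i hi := by rw [hd.self i hi, zero_div]
  symm i hi j hj := by rw [hd.symm i hi j hj]
  triangle i hi j hj k hk := by
    rw [← add_div]
    exact div_le_div_of_nonneg_right (hd.triangle i hi j hj k hk) hpos.le
  sum_eq_one := by
    simp only [← Finset.sum_div]
    exact div_self hpos.ne'
  nonneg i hi j hj := div_nonneg (hd.nonneg hi hj) hpos.le
  zero_on i hi j hj := by rw [hT i hi j hj, zero_div]
  const_on i hi j hj k hk := by
    have h1 := hd.triangle i (hTV hi) k hk j (hTV hj)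
    have h2 := hd.triangle j (hTV hj) k hk i (hTV hi)
    rw [hT i hi j hj, zero_add] at h1
    rw [hT j hj i hi, zero_add] at h2
    rw [le_antisymm h1 h2]

lemma isFeasible_cutMetric {V T R : Finset (Fin n)} (hTV : T ⊆ V) (hne : R.Nonempty)
    (hR : R ⊂ V) (hRT : Disjoint R T) :
    IsFeasible V T fun i j => cutMetric R i j / ∑ i ∈ V, ∑ j ∈ V, cutMetric R i j := by
  refine (cutMetric_isPseudometricOn V R).isFeasible_div hTV (fun i hi j hj => ?_)
    (sum_cutMetric_pos hne hR)
  have h1 := Finset.disjoint_right.1 hRT hi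
  have h2 := Finset.disjoint_right.1 hRT hj
  simp [cutMetric, h1, h2]

lemma objective_cutMetric (P : Matrix (Fin n) (Fin n) ℝ) (V R : Finset (Fin n)) :
    objective P V (fun i j => cutMetric R i j / ∑ i ∈ V, ∑ j ∈ V, cutMetric R i j)
      = cutValue P V R := by
  simp only [objective, cutValue, Finset.sum_div, div_mul_eq_mul_div]

lemma IsFeasible.isPseudometricOn {V T : Finset (Fin n)} {δ : Fin n → Fin n → ℝ}
    (h : IsFeasible V T δ) : IsPseudometricOn V δ :=
  ⟨h.self, h.symm, h.triangle⟩

lemma IsFeasible.congr {V T : Finset (Fin n)} {δ δ' : Fin n → Fin n → ℝ}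
    (h : IsFeasible V T δ) (hTV : T ⊆ V) (heq : ∀ i ∈ V, ∀ j ∈ V, δ' i j = δ i j) :
    IsFeasible V T δ' where
  self i hi := by rw [heq i hi i hi, h.self i hi]
  symm i hi j hj := by rw [heq i hi j hj, heq j hj i hi, h.symm i hi j hj]
  triangle i hi j hj k hk := by
    rw [heq i hi j hj, heq i hi k hk, heq k hk j hj]
    exact h.triangle i hi j hj k hk
  sum_eq_one := by
    rw [← h.sum_eq_one]
    exact Finset.sum_congr rfl fun i hi => Finset.sum_congr rfl fun j hj => heq i hi j hj
  nonneg i hi j hj := by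
    rw [heq i hi j hj]
    exact h.nonneg i hi j hj
  zero_on i hi j hj := by rw [heq i (hTV hi) j (hTV hj), h.zero_on i hi j hj]
  const_on i hi j hj k hk := by
    rw [heq i (hTV hi) k hk, heq j (hTV hj) k hk, h.const_on i hi j hj k hk]

lemma IsFeasible.le_one {V T : Finset (Fin n)} {δ : Fin n → Fin n → ℝ}
    (h : IsFeasible V T δ) {i j : Fin n} (hi : i ∈ V) (hj : j ∈ V) : δ i j ≤ 1 := by
  rw [← h.sum_eq_one]
  exact (Finset.single_le_sum (f := fun j => δ i j) (fun k hk => h.nonneg i hi k hk) hj).trans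
    (Finset.single_le_sum (f := fun i => ∑ j ∈ V, δ i j)
      (fun k hk => Finset.sum_nonneg fun l hl => h.nonneg k hk l hl) hi)

lemma isClosed_setOf_isFeasible (V T : Finset (Fin n)) :
    IsClosed {δ : Fin n → Fin n → ℝ | IsFeasible V T δ} := by
  have heq : {δ : Fin n → Fin n → ℝ | IsFeasible V T δ} =
      {δ | ∀ i ∈ V, δ i i = 0} ∩ {δ | ∀ i ∈ V, ∀ j ∈ V, δ i j = δ j i} ∩
      {δ | ∀ i ∈ V, ∀ j ∈ V, ∀ k ∈ V, δ i j ≤ δ i k + δ k j} ∩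
      {δ | ∑ i ∈ V, ∑ j ∈ V, δ i j = 1} ∩ {δ | ∀ i ∈ V, ∀ j ∈ V, 0 ≤ δ i j} ∩
      {δ | ∀ i ∈ T, ∀ j ∈ T, δ i j = 0} ∩
      {δ | ∀ i ∈ T, ∀ j ∈ T, ∀ k ∈ V, δ i k = δ j k} := by
    ext δ
    exact ⟨fun h => ⟨⟨⟨⟨⟨⟨h.self, h.symm⟩, h.triangle⟩, h.sum_eq_one⟩, h.nonneg⟩, h.zero_on⟩,
      h.const_on⟩, fun ⟨⟨⟨⟨⟨⟨h1, h2⟩, h3⟩, h4⟩, h5⟩, h6⟩, h7⟩ => ⟨h1, h2, h3, h4, h5, h6, h7⟩⟩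
  rw [heq]
  simp only [Set.ofPred_forall]
  refine ((((((?_ : IsClosed _).inter ?_).inter ?_).inter ?_).inter ?_).inter ?_).inter ?_
  · exact isClosed_iInter fun i => isClosed_iInter fun _ =>
      isClosed_eq (by fun_prop) (by fun_prop)
  · exact isClosed_iInter fun i => isClosed_iInter fun _ => isClosed_iInter fun j =>
      isClosed_iInter fun _ => isClosed_eq (by fun_prop) (by fun_prop)
  · exact isClosed_iInter fun i => isClosed_iInter fun _ => isClosed_iInter fun j =>
      isClosed_iInter fun _ => isClosed_iInter fun k => isClosed_iInter fun _ =>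
        isClosed_le (by fun_prop) (by fun_prop)
  · exact isClosed_eq (by fun_prop) (by fun_prop)
  · exact isClosed_iInter fun i => isClosed_iInter fun _ => isClosed_iInter fun j =>
      isClosed_iInter fun _ => isClosed_le (by fun_prop) (by fun_prop)
  · exact isClosed_iInter fun i => isClosed_iInter fun _ => isClosed_iInter fun j =>
      isClosed_iInter fun _ => isClosed_eq (by fun_prop) (by fun_prop)
  · exact isClosed_iInter fun i => isClosed_iInter fun _ => isClosed_iInter fun j =>
      isClosed_iInter fun _ => isClosed_iInter fun k => isClosed_iInter fun _ =>
        isClosed_eq (by fun_prop) (by fun_prop)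

lemma exists_isOptimal (P : Matrix (Fin n) (Fin n) ℝ) {V T : Finset (Fin n)}
    (hT : T ⊂ V) (hV : 2 ≤ V.card) : ∃ δ, IsOptimal P V T δ := by
  obtain ⟨v, hv, hvT⟩ := Finset.exists_of_ssubset hT
  have hvV : {v} ⊂ V := by
    refine (Finset.singleton_subset_iff.2 hv).ssubset_of_ne fun h => ?_
    rw [← h, Finset.card_singleton] at hV
    omega
  have hfeas := isFeasible_cutMetric hT.subset (Finset.singleton_nonempty v) hvV
    (Finset.disjoint_singleton_left.2 hvT)
  let trunc : (Fin n → Fin n → ℝ) → Fin n → Fin n → ℝ :=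
    fun δ i j => if i ∈ V ∧ j ∈ V then δ i j else 0
  have htrunc : ∀ δ, ∀ i ∈ V, ∀ j ∈ V, trunc δ i j = δ i j := fun δ i hi j hj => by
    simp [trunc, hi, hj]
  let box : Set (Fin n → Fin n → ℝ) :=
    Set.univ.pi fun _ => Set.univ.pi fun _ => Set.Icc 0 1
  have hbox : ∀ δ, IsFeasible V T δ → trunc δ ∈ box := by
    intro δ hδ i _ j _
    by_cases h : i ∈ V ∧ j ∈ V
    · simp only [trunc, if_pos h]
      exact ⟨hδ.nonneg i h.1 j h.2, hδ.le_one h.1 h.2⟩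
    · simp [trunc, if_neg h]
  have hcompact : IsCompact (box ∩ {δ | IsFeasible V T δ}) :=
    (isCompact_univ_pi fun _ => isCompact_univ_pi fun _ => isCompact_Icc).inter_right
      (isClosed_setOf_isFeasible V T)
  have hcont : Continuous (objective P V) := by
    unfold objective
    fun_prop
  obtain ⟨δ, hδ, hmin⟩ := hcompact.exists_isMinOn
    ⟨_, hbox _ hfeas, hfeas.congr hT.subset (htrunc _)⟩ hcont.continuousOn
  refine ⟨δ, hδ.2, fun δ' hδ' => ?_⟩
  have h1 := hmin ⟨hbox _ hδ', hδ'.congr hT.subset (htrunc δ')⟩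
  have h2 : objective P V (trunc δ') = objective P V δ' :=
    Finset.sum_congr rfl fun i hi => Finset.sum_congr rfl fun j hj => by
      rw [htrunc δ' i hi j hj]
  rw [← h2]
  exact h1

/-- A combination of cut metrics is realised by an `ℓ₁` embedding with a cut decomposition. -/
lemma InCutCone.exists_isCutDecomposition {V : Finset (Fin n)} {D : Fin n → Fin n → ℝ}
    (hD : InCutCone V D) :
    ∃ (m : ℕ) (f : Fin n → Fin m → ℝ) (𝒞 : Finset (Finset (Fin n))) (a : Finset (Fin n) → ℝ),
      (∀ i ∈ V, ∀ j ∈ V, ∑ k, |f i k - f j k| = D i j) ∧ IsCutDecomposition V f 𝒞 a := by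
  obtain ⟨a, ha, hDa⟩ := hD
  set 𝒞 := V.powerset.filter fun S => S.Nonempty ∧ S ⊂ V ∧ 0 < a S with h𝒞
  have hsum : ∀ i ∈ V, ∀ j ∈ V, D i j = ∑ S ∈ 𝒞, a S * PartitionGraph.cutMetric S i j := by
    intro i hi j hj
    rw [hDa i hi j hj, h𝒞]
    symm
    refine Finset.sum_filter_of_ne fun S hS hne => ⟨?_, ?_, ?_⟩
    · rw [Finset.nonempty_iff_ne_empty]
      rintro rfl
      simp [PartitionGraph.cutMetric] at hne
    · refine (Finset.mem_powerset.1 hS).ssubset_of_ne ?_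
      rintro rfl
      simp [PartitionGraph.cutMetric, hi, hj] at hne
    · exact (ha S).lt_of_ne' (left_ne_zero_of_mul hne)
  let e := 𝒞.equivFin
  let f : Fin n → Fin 𝒞.card → ℝ := fun i k =>
    if i ∈ (e.symm k : Finset (Fin n)) then a (e.symm k) else 0
  have hf : ∀ i ∈ V, ∀ j ∈ V, ∑ k, |f i k - f j k| = D i j := by
    intro i hi j hj
    rw [hsum i hi j hj, ← Finset.sum_coe_sort 𝒞, ← Equiv.sum_comp e.symm]
    refine Finset.sum_congr rfl fun k _ => ?_
    have := ha (e.symm k)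
    by_cases h1 : i ∈ (e.symm k : Finset (Fin n)) <;>
      by_cases h2 : j ∈ (e.symm k : Finset (Fin n)) <;>
      simp [f, PartitionGraph.cutMetric, h1, h2, abs_of_nonneg this]
  exact ⟨𝒞.card, f, 𝒞, a, hf, fun S hS => (Finset.mem_filter.1 hS).2, fun i hi j hj =>
    (hf i hi j hj).trans (hsum i hi j hj)⟩

lemma IsCutDecomposition.cutMetric_eq_zero {V : Finset (Fin n)} {m : ℕ} {f : Fin n → Fin m → ℝ}
    {𝒞 : Finset (Finset (Fin n))} {a : Finset (Fin n) → ℝ} (h : IsCutDecomposition V f 𝒞 a)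
    {i j : Fin n} (hi : i ∈ V) (hj : j ∈ V) (hf : ∑ k, |f i k - f j k| ≤ 0)
    {S : Finset (Fin n)} (hS : S ∈ 𝒞) : cutMetric S i j = 0 := by
  have hnn : ∀ R ∈ 𝒞, 0 ≤ a R * cutMetric R i j := fun R hR =>
    mul_nonneg (h.1 R hR).2.2.le (cutMetric_nonneg R i j)
  have h1 : ∑ R ∈ 𝒞, a R * cutMetric R i j = 0 :=
    le_antisymm (h.2 i hi j hj ▸ hf) (Finset.sum_nonneg hnn)
  have h2 := (Finset.sum_eq_zero_iff_of_nonneg hnn).1 h1 S hS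
  exact (mul_eq_zero.1 h2).resolve_left (h.1 S hS).2.2.ne'

/-- All choices asked for in the subroutine FindComp can be made. -/
theorem exists_findComp {C : ℝ} (hC : 72 ≤ C) (P : Matrix (Fin n) (Fin n) ℝ)
    {V T : Finset (Fin n)} (hT : T ⊂ V) (hV : 2 ≤ V.card) : ∃ S, FindComp C P V T S := by
  obtain ⟨δ, hδ⟩ := exists_isOptimal P hT hV
  have hpm := hδ.1.isPseudometricOn
  obtain ⟨D, hD, hDδ⟩ := exists_cutCone_embedding hV hpm
  obtain ⟨m, f, 𝒞, a, hf, hdec⟩ := hD.exists_isCutDecomposition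
  have hlog : 0 ≤ Real.log V.card := Real.log_natCast_nonneg _
  have hemb : IsEmbedding C V δ f := by
    intro i hi j hj
    rw [hf i hi j hj]
    refine ⟨(hDδ i hi j hj).1, (hDδ i hi j hj).2.trans ?_⟩
    exact mul_le_mul_of_nonneg_right (mul_le_mul_of_nonneg_right hC hlog) (hpm.nonneg hi hj)
  have hne : 𝒞.Nonempty := by
    rw [Finset.nonempty_iff_ne_empty]
    rintro rfl
    have h1 : ∑ i ∈ V, ∑ j ∈ V, δ i j ≤ 0 :=
      Finset.sum_nonpos fun i hi => Finset.sum_nonpos fun j hj => by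
        have h2 := (hemb i hi j hj).1
        rwa [hdec.2 i hi j hj, Finset.sum_empty] at h2
    rw [hδ.1.sum_eq_one] at h1
    norm_num at h1
  obtain ⟨S₀, hS₀, hmin⟩ := 𝒞.exists_min_image (cutValue P V) hne
  have hside : Disjoint S₀ T ∨ Disjoint (V \ S₀) T := by
    by_contra! hcon
    obtain ⟨i, hiS, hiT⟩ := Finset.not_disjoint_iff.1 hcon.1
    obtain ⟨j, hjS, hjT⟩ := Finset.not_disjoint_iff.1 hcon.2
    have h1 := (hemb i (hT.subset hiT) j (hT.subset hjT)).2
    rw [hδ.1.zero_on i hiT j hjT, mul_zero] at h1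
    have h2 := hdec.cutMetric_eq_zero (hT.subset hiT) (hT.subset hjT) h1 hS₀
    simp [cutMetric, hiS, (Finset.mem_sdiff.1 hjS).2] at h2
  rcases hside with h | h
  · exact ⟨S₀, δ, hδ, m, f, hemb, 𝒞, a, hdec, S₀, hS₀, hmin, Or.inl rfl, h⟩
  · exact ⟨V \ S₀, δ, hδ, m, f, hemb, 𝒞, a, hdec, S₀, hS₀, hmin, Or.inr rfl, h⟩

lemma FindComp.disjoint {C : ℝ} {P : Matrix (Fin n) (Fin n) ℝ} {V T S : Finset (Fin n)}
    (h : FindComp C P V T S) : Disjoint S T := by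
  obtain ⟨_, _, _, _, _, _, _, _, _, _, _, _, h⟩ := h
  exact h

lemma FindComp.nonempty {C : ℝ} {P : Matrix (Fin n) (Fin n) ℝ} {V T S : Finset (Fin n)}
    (h : FindComp C P V T S) : S.Nonempty := by
  obtain ⟨_, _, _, _, _, _, _, hdec, S₀, hS₀, _, rfl | rfl, _⟩ := h
  · exact (hdec.1 _ hS₀).1
  · exact Finset.sdiff_nonempty.2 (hdec.1 S₀ hS₀).2.1.not_subset

lemma FindComp.ssubset {C : ℝ} {P : Matrix (Fin n) (Fin n) ℝ} {V T S : Finset (Fin n)}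
    (h : FindComp C P V T S) : S ⊂ V := by
  obtain ⟨_, _, _, _, _, _, _, hdec, S₀, hS₀, _, rfl | rfl, _⟩ := h
  · exact (hdec.1 _ hS₀).2.1
  · exact Finset.sdiff_ssubset (hdec.1 S₀ hS₀).2.1.subset (hdec.1 S₀ hS₀).1

/-- The cut of least value in the decomposition is within the distortion of the optimum of the
linear program. -/
lemma IsCutDecomposition.cutValue_le {C : ℝ} {P : Matrix (Fin n) (Fin n) ℝ}
    (h0 : ∀ i j, 0 ≤ P i j) {V T : Finset (Fin n)} {δ : Fin n → Fin n → ℝ}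
    (hδ : IsFeasible V T δ) {m : ℕ} {f : Fin n → Fin m → ℝ} (hf : IsEmbedding C V δ f)
    {𝒞 : Finset (Finset (Fin n))} {a : Finset (Fin n) → ℝ} (h : IsCutDecomposition V f 𝒞 a)
    {S₀ : Finset (Fin n)} (hmin : ∀ S ∈ 𝒞, cutValue P V S₀ ≤ cutValue P V S) :
    cutValue P V S₀ ≤ C * Real.log V.card * objective P V δ := by
  have hnorm : ∑ S ∈ 𝒞, a S * ∑ i ∈ V, ∑ j ∈ V, cutMetric S i j
      = ∑ i ∈ V, ∑ j ∈ V, ∑ k, |f i k - f j k| := by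
    simp only [Finset.mul_sum]
    rw [Finset.sum_comm]
    refine Finset.sum_congr rfl fun i hi => ?_
    rw [Finset.sum_comm]
    exact Finset.sum_congr rfl fun j hj => (h.2 i hi j hj).symm
  have hobj : ∑ S ∈ 𝒞, a S * ∑ i ∈ V, ∑ j ∈ V, cutMetric S i j * P i j
      = ∑ i ∈ V, ∑ j ∈ V, (∑ k, |f i k - f j k|) * P i j := by
    simp only [Finset.mul_sum]
    rw [Finset.sum_comm]
    refine Finset.sum_congr rfl fun i hi => ?_
    rw [Finset.sum_comm]
    refine Finset.sum_congr rfl fun j hj => ?_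
    rw [h.2 i hi j hj, Finset.sum_mul]
    exact Finset.sum_congr rfl fun S _ => (mul_assoc _ _ _).symm
  have h1 : 1 ≤ ∑ i ∈ V, ∑ j ∈ V, ∑ k, |f i k - f j k| := by
    rw [← hδ.sum_eq_one]
    exact Finset.sum_le_sum fun i hi => Finset.sum_le_sum fun j hj => (hf i hi j hj).1
  calc cutValue P V S₀
      ≤ cutValue P V S₀ * ∑ i ∈ V, ∑ j ∈ V, ∑ k, |f i k - f j k| :=
        le_mul_of_one_le_right (cutValue_nonneg h0 V S₀) h1
    _ = ∑ S ∈ 𝒞, cutValue P V S₀ * (a S * ∑ i ∈ V, ∑ j ∈ V, cutMetric S i j) := by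
        rw [← hnorm, Finset.mul_sum]
    _ ≤ ∑ S ∈ 𝒞, a S * ∑ i ∈ V, ∑ j ∈ V, cutMetric S i j * P i j := by
        refine Finset.sum_le_sum fun S hS => ?_
        obtain ⟨hne, hSV, ha⟩ := h.1 S hS
        have hpos := sum_cutMetric_pos hne hSV
        have h2 := hmin S hS
        rw [cutValue.eq_def P V S, le_div_iff₀ hpos] at h2
        rw [mul_left_comm]
        exact mul_le_mul_of_nonneg_left h2 ha.le
    _ = ∑ i ∈ V, ∑ j ∈ V, (∑ k, |f i k - f j k|) * P i j := hobj
    _ ≤ ∑ i ∈ V, ∑ j ∈ V, (C * Real.log V.card * δ i j) * P i j :=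
        Finset.sum_le_sum fun i hi => Finset.sum_le_sum fun j hj =>
          mul_le_mul_of_nonneg_right (hf i hi j hj).2 (h0 i j)
    _ = C * Real.log V.card * objective P V δ := by
        simp only [objective, Finset.mul_sum, mul_assoc]

/-- FindComp returns an approximately sparsest cut. -/
theorem FindComp.expansion_le {C : ℝ} (hC : 0 ≤ C) {P : Matrix (Fin n) (Fin n) ℝ}
    (hP : P.IsSymm) (h0 : ∀ i j, 0 ≤ P i j) {V T S R : Finset (Fin n)}
    (h : FindComp C P V T S) (hTV : T ⊆ V) (hne : R.Nonempty) (hR : R ⊂ V)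
    (hRT : Disjoint R T) :
    expansion P V S ≤ 2 * (C * Real.log V.card) * expansion P V R := by
  obtain ⟨δ, hδ, m, f, hf, 𝒞, a, hdec, S₀, hS₀, hmin, hS, -⟩ := h
  obtain ⟨hne₀, hS₀V, -⟩ := hdec.1 S₀ hS₀
  have hSeq : expansion P V S = expansion P V S₀ := by
    rcases hS with rfl | rfl
    · rfl
    · exact expansion_sdiff hP hS₀V.subset
  have hlog : 0 ≤ C * Real.log V.card := mul_nonneg hC (Real.log_natCast_nonneg _)
  have h1 := hdec.cutValue_le h0 hδ.1 hf hmin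
  have h2 := hδ.2 _ (isFeasible_cutMetric hTV hne hR hRT)
  rw [objective_cutMetric] at h2
  calc expansion P V S ≤ cutValue P V S₀ * V.card :=
        hSeq ▸ expansion_le_cutValue hP h0 hne₀ hS₀V
    _ ≤ C * Real.log V.card * cutValue P V R * V.card :=
        mul_le_mul_of_nonneg_right (h1.trans (mul_le_mul_of_nonneg_left h2 hlog))
          (Nat.cast_nonneg _)
    _ = C * Real.log V.card * (cutValue P V R * V.card) := mul_assoc _ _ _
    _ ≤ C * Real.log V.card * (2 * expansion P V R) :=
        mul_le_mul_of_nonneg_left (cutValue_le_expansion hP h0 hne hR) hlog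
    _ = _ := by ring

lemma weight_union_left (P : Matrix (Fin n) (Fin n) ℝ) {A A' : Finset (Fin n)}
    (h : Disjoint A A') (B : Finset (Fin n)) :
    weight P (A ∪ A') B = weight P A B + weight P A' B :=
  Finset.sum_union h

lemma weight_union_right {P : Matrix (Fin n) (Fin n) ℝ} (hP : P.IsSymm) {B B' : Finset (Fin n)}
    (h : Disjoint B B') (A : Finset (Fin n)) :
    weight P A (B ∪ B') = weight P A B + weight P A B' := by
  rw [weight_comm hP, weight_union_left P h, weight_comm hP B, weight_comm hP B']

lemma weight_mono_right {P : Matrix (Fin n) (Fin n) ℝ} (h0 : ∀ i j, 0 ≤ P i j)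
    (A : Finset (Fin n)) {B B' : Finset (Fin n)} (h : B ⊆ B') :
    weight P A B ≤ weight P A B' :=
  Finset.sum_le_sum fun i _ => Finset.sum_le_sum_of_subset_of_nonneg h fun j _ _ => h0 i j

lemma mass_mul_card (P : Matrix (Fin n) (Fin n) ℝ) {S : Finset (Fin n)} (h : S.Nonempty) :
    mass P S * S.card = weight P S S :=
  div_mul_cancel₀ _ (by exact_mod_cast h.card_pos.ne')

/-- The rows of `S` have total weight `|S|`. -/
lemma weight_compl {P : Matrix (Fin n) (Fin n) ℝ} (hP : P.IsSymm) (h1 : ∀ i, ∑ j, P i j = 1)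
    {S : Finset (Fin n)} (hS : S.Nonempty) :
    weight P S (Finset.univ \ S) = (1 - mass P S) * S.card := by
  have h : weight P S Finset.univ = S.card := by
    simp [weight, h1]
  rw [← Finset.union_sdiff_of_subset (Finset.subset_univ S),
    weight_union_right hP Finset.disjoint_sdiff] at h
  rw [sub_mul, mass_mul_card P hS]
  linarith

lemma one_sub_mass_le_expansion {P : Matrix (Fin n) (Fin n) ℝ} (hP : P.IsSymm)
    (h0 : ∀ i j, 0 ≤ P i j) (h1 : ∀ i, ∑ j, P i j = 1) {S : Finset (Fin n)}
    (hne : S.Nonempty) (hS : S ⊂ Finset.univ) : 1 - mass P S ≤ expansion P Finset.univ S := by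
  have h2 : 0 < (S.card : ℝ) := by exact_mod_cast hne.card_pos
  have h3 : 0 < (Finset.univ \ S).card := (Finset.sdiff_nonempty.2 hS.not_subset).card_pos
  have h4 : 1 - mass P S = weight P S (Finset.univ \ S) / S.card := by
    rw [weight_compl hP h1 hne, mul_div_cancel_right₀ _ h2.ne']
  rw [h4, expansion]
  refine div_le_div_of_nonneg_left (weight_nonneg h0 _ _) ?_ ?_
  · exact_mod_cast lt_min hne.card_pos h3
  · exact_mod_cast min_le_left _ _

/-- If a sparse cut splits `S`, then the side of larger mass loses little mass. -/
lemma mass_le_mass_side {P : Matrix (Fin n) (Fin n) ℝ} (hP : P.IsSymm) {S K : Finset (Fin n)}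
    {ε : ℝ} (hε : 0 ≤ ε) (hne : K.Nonempty) (hK : K ⊂ S) (hexp : expansion P S K < ε)
    (hmass : mass P (S \ K) ≤ mass P K) :
    mass P S ≤ mass P K + 2 * ε * (Real.log S.card - Real.log K.card) := by
  have hne' : (S \ K).Nonempty := Finset.sdiff_nonempty.2 hK.not_subset
  have hk : 0 < (K.card : ℝ) := by exact_mod_cast hne.card_pos
  have hl : 0 < ((S \ K).card : ℝ) := by exact_mod_cast hne'.card_pos
  have hs : (S.card : ℝ) = K.card + (S \ K).card := by
    rw [add_comm]
    exact_mod_cast (Finset.card_sdiff_add_card_eq_card hK.subset).symm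
  have hmin : 0 < ((min K.card (S \ K).card : ℕ) : ℝ) := by
    exact_mod_cast lt_min hne.card_pos hne'.card_pos
  have hminle : ((min K.card (S \ K).card : ℕ) : ℝ) ≤ (S \ K).card := by
    exact_mod_cast min_le_right _ _
  rw [expansion, div_lt_iff₀ hmin] at hexp
  have hsplit : weight P S S
      = weight P K K + weight P (S \ K) (S \ K) + 2 * weight P K (S \ K) := by
    conv_lhs => rw [← Finset.union_sdiff_of_subset hK.subset]
    rw [weight_union_left P Finset.disjoint_sdiff, weight_union_right hP Finset.disjoint_sdiff,
      weight_union_right hP Finset.disjoint_sdiff, weight_comm hP (S \ K) K]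
    ring
  rw [← mass_mul_card P hne, ← mass_mul_card P hne',
    ← mass_mul_card P (hne.mono hK.subset)] at hsplit
  have hlog : ((S \ K).card : ℝ) / S.card ≤ Real.log S.card - Real.log K.card := by
    rw [← Real.log_div (by rw [hs]; positivity) hk.ne']
    refine le_trans (le_of_eq ?_) (Real.one_sub_inv_le_log_of_pos (by rw [hs]; positivity))
    rw [hs, inv_div]
    field_simp
    ring
  have h1 : mass P S * S.card
      ≤ (mass P K + 2 * ε * (((S \ K).card : ℝ) / S.card)) * S.card := by
    have h2 : (mass P K + 2 * ε * (((S \ K).card : ℝ) / S.card)) * S.card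
        = mass P K * S.card + 2 * ε * (S \ K).card := by
      rw [hs]
      field_simp
    rw [h2, hsplit, hs]
    have h3 := mul_le_mul_of_nonneg_right hmass hl.le
    have h4 := mul_le_mul_of_nonneg_left hminle hε
    linarith
  have h2 := le_of_mul_le_mul_right h1 (by rw [hs]; positivity)
  have h3 := mul_le_mul_of_nonneg_left hlog (by linarith : 0 ≤ 2 * ε)
  linarith

/-- The properties of an extracted component. -/
structure IsComponent (c : ℝ) (P : Matrix (Fin n) (Fin n) ℝ) (β : ℝ) (S : Finset (Fin n)) :
    Prop where
  nonempty : S.Nonempty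
  mass_ge : 1 - β ≤ mass P S
  expansion_ge : ∀ R : Finset (Fin n), R.Nonempty → R ⊂ S →
    c * (β / Real.log n ^ 2) ≤ expansion P S R

/-- The invariant of the outer loop of Partition Graph. -/
structure OuterInvariant (c : ℝ) (P : Matrix (Fin n) (Fin n) ℝ) (β : ℝ)
    (𝒮 : Finset (Finset (Fin n))) (T : Finset (Fin n)) : Prop where
  isComponent : ∀ S ∈ 𝒮, IsComponent c P β S
  disjoint : ∀ S ∈ 𝒮, ∀ S' ∈ 𝒮, S ≠ S' → Disjoint S S'
  sup_eq : 𝒮.sup id = T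
  weight_le : weight P T (Finset.univ \ T) ≤ β * T.card

/-- The invariant of the states of Partition Graph. -/
def Invariant (c : ℝ) (P : Matrix (Fin n) (Fin n) ℝ) (β : ℝ) : State n → Prop
  | .outer 𝒮 T => OuterInvariant c P β 𝒮 T
  | .inner 𝒮 T S => OuterInvariant c P β 𝒮 T ∧ S.Nonempty ∧ Disjoint S T ∧
      1 - β / 8 - 2 * (β / (8 * Real.log n)) * (Real.log n - Real.log S.card) ≤ mass P S
  | .done 𝒮 U => ∃ T, OuterInvariant c P β 𝒮 T ∧ U = Finset.univ \ T ∧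
      ∀ R : Finset (Fin n), R.Nonempty → R ⊆ U →
        c * (β / Real.log n) ≤ weight P R (Finset.univ \ R) / R.card

lemma OuterInvariant.insert {c β : ℝ} {P : Matrix (Fin n) (Fin n) ℝ} (hP : P.IsSymm)
    (h0 : ∀ i j, 0 ≤ P i j) (h1 : ∀ i, ∑ j, P i j = 1) {𝒮 : Finset (Finset (Fin n))}
    {T S : Finset (Fin n)} (h : OuterInvariant c P β 𝒮 T) (hST : Disjoint S T)
    (hS : IsComponent c P β S) : OuterInvariant c P β (insert S 𝒮) (T ∪ S) := by
  have hsub : ∀ S' ∈ 𝒮, S' ⊆ T := fun S' hS' => h.sup_eq ▸ Finset.le_sup (f := id) hS'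
  refine ⟨?_, ?_, ?_, ?_⟩
  · intro S' hS'
    rcases Finset.mem_insert.1 hS' with rfl | hS'
    · exact hS
    · exact h.isComponent S' hS'
  · intro S₁ hS₁ S₂ hS₂ hne
    rcases Finset.mem_insert.1 hS₁ with rfl | h₁ <;> rcases Finset.mem_insert.1 hS₂ with rfl | h₂
    · exact absurd rfl hne
    · exact hST.mono_right (hsub S₂ h₂)
    · exact (hST.mono_right (hsub S₁ h₁)).symm
    · exact h.disjoint S₁ h₁ S₂ h₂ hne
  · rw [Finset.sup_insert, h.sup_eq, sup_comm]
    rfl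
  · have h2 : weight P S (Finset.univ \ S) ≤ β * S.card := by
      rw [weight_compl hP h1 hS.nonempty]
      exact mul_le_mul_of_nonneg_right (by linarith [hS.mass_ge]) (Nat.cast_nonneg _)
    have h3 : weight P T (Finset.univ \ (T ∪ S)) ≤ weight P T (Finset.univ \ T) :=
      weight_mono_right h0 _ (Finset.sdiff_subset_sdiff le_rfl Finset.subset_union_left)
    have h4 : weight P S (Finset.univ \ (T ∪ S)) ≤ weight P S (Finset.univ \ S) :=
      weight_mono_right h0 _ (Finset.sdiff_subset_sdiff le_rfl Finset.subset_union_right)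
    rw [weight_union_left P hST.symm, Finset.card_union_of_disjoint hST.symm]
    push_cast
    linarith [h.weight_le]

/-- If no sparse cut avoiding `T` was found and the rest has small mass, then all subsets of the
rest expand. -/
lemma rest_expands {C β : ℝ} (hC : 0 < C) (hn : 2 ≤ n) (hβ : 0 < β)
    {P : Matrix (Fin n) (Fin n) ℝ} (hP : P.IsSymm) (h0 : ∀ i j, 0 ≤ P i j)
    (h1 : ∀ i, ∑ j, P i j = 1) {T S R : Finset (Fin n)}
    (hT : weight P T (Finset.univ \ T) ≤ β * T.card) (hfind : FindComp C P Finset.univ T S)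
    (hexp : β / 8 ≤ expansion P Finset.univ S)
    (hmass : mass P (Finset.univ \ T) ≤ 1 - β / 8) (hne : R.Nonempty)
    (hR : R ⊆ Finset.univ \ T) :
    1 / (128 * C) * (β / Real.log n) ≤ weight P R (Finset.univ \ R) / R.card := by
  have hlog : 0 < Real.log n := Real.log_pos (by exact_mod_cast hn)
  have hUne : (Finset.univ \ T).Nonempty := hne.mono hR
  have hr : 0 < (R.card : ℝ) := by exact_mod_cast hne.card_pos
  have hRU : (R.card : ℝ) ≤ (Finset.univ \ T).card := by
    exact_mod_cast Finset.card_le_card hR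
  have hTcard : ((Finset.univ \ T).card : ℝ) ≤ 8 * T.card := by
    have h2 := weight_compl hP h1 hUne
    rw [Finset.sdiff_sdiff_eq_self (Finset.subset_univ T), weight_comm hP] at h2
    have h3 : β / 8 * (Finset.univ \ T).card ≤ (1 - mass P (Finset.univ \ T)) *
        (Finset.univ \ T).card := mul_le_mul_of_nonneg_right (by linarith) (Nat.cast_nonneg _)
    have h4 : β * (Finset.univ \ T).card ≤ β * (8 * T.card) := by linarith
    exact le_of_mul_le_mul_left h4 hβ
  have hTR : Disjoint R T := (Finset.subset_sdiff.1 hR).2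
  have hTRc : (T.card : ℝ) ≤ (Finset.univ \ R).card := by
    exact_mod_cast Finset.card_le_card
      (Finset.subset_sdiff.2 ⟨Finset.subset_univ T, hTR.symm⟩)
  have hRc : 0 < ((Finset.univ \ R).card : ℝ) := by linarith
  have hRuniv : R ⊂ Finset.univ := by
    refine (Finset.subset_univ R).ssubset_of_ne ?_
    rintro rfl
    simp at hRc
  have hmin : (R.card : ℝ) / 8 ≤ ((min R.card (Finset.univ \ R).card : ℕ) : ℝ) := by
    rw [Nat.cast_min]
    exact le_min (by linarith) (by linarith)
  have h2 := hfind.expansion_le hC.le hP h0 (Finset.subset_univ T) hne hRuniv hTR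
  rw [Finset.card_univ, Fintype.card_fin] at h2
  have h3 := hexp.trans h2
  rw [expansion, ← mul_div_assoc, le_div_iff₀ (by linarith)] at h3
  have h4 := (mul_le_mul_of_nonneg_left hmin (by linarith : 0 ≤ β / 8)).trans h3
  rw [le_div_iff₀ hr, div_mul_div_comm, div_mul_eq_mul_div, div_le_iff₀ (by positivity)]
  linarith

lemma isComponent_of_break {C β : ℝ} (hC : 0 < C) (hn : 2 ≤ n) (hβ : 0 < β)
    {P : Matrix (Fin n) (Fin n) ℝ} (hP : P.IsSymm) (h0 : ∀ i j, 0 ≤ P i j)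
    {S S' R : Finset (Fin n)} (hfind : FindComp C P S ∅ S')
    (hexp : β / (8 * Real.log n) ≤ expansion P S S') (hne : R.Nonempty) (hR : R ⊂ S) :
    1 / (128 * C) * (β / Real.log n ^ 2) ≤ expansion P S R := by
  have hlog : 0 < Real.log n := Real.log_pos (by exact_mod_cast hn)
  have hE : 0 ≤ expansion P S R := div_nonneg (weight_nonneg h0 _ _) (Nat.cast_nonneg _)
  have hlogS : Real.log S.card ≤ Real.log n := by
    refine Real.log_le_log ?_ ?_
    · exact_mod_cast (hne.mono hR.subset).card_pos
    · exact_mod_cast (card_finset_fin_le S)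
  have h2 := hfind.expansion_le hC.le hP h0 (Finset.empty_subset S) hne hR
    (Finset.disjoint_empty_right R)
  have h3 : 2 * (C * Real.log S.card) * expansion P S R
      ≤ 2 * (C * Real.log n) * expansion P S R :=
    mul_le_mul_of_nonneg_right (by nlinarith) hE
  have h4 := hexp.trans (h2.trans h3)
  rw [div_le_iff₀ (by positivity)] at h4
  rw [div_mul_div_comm, div_le_iff₀ (by positivity)]
  have h5 : 0 ≤ expansion P S R * (C * Real.log n ^ 2) := by positivity
  nlinarith

lemma one_sub_le_mass {β : ℝ} (hn : 2 ≤ n) (hβ : 0 < β) {P : Matrix (Fin n) (Fin n) ℝ}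
    {S : Finset (Fin n)}
    (h : 1 - β / 8 - 2 * (β / (8 * Real.log n)) * (Real.log n - Real.log S.card) ≤ mass P S) :
    1 - β ≤ mass P S := by
  have hlog : 0 < Real.log n := Real.log_pos (by exact_mod_cast hn)
  have h2 : β / (8 * Real.log n) * Real.log n = β / 8 := by field_simp
  have h3 : 0 ≤ β / (8 * Real.log n) * Real.log S.card :=
    mul_nonneg (by positivity) (Real.log_natCast_nonneg _)
  linarith

lemma one_sub_le_mass_of_lt {β : ℝ} (hβ : 0 < β) {P : Matrix (Fin n) (Fin n) ℝ}
    {S : Finset (Fin n)} (hS : S.Nonempty) (h : 1 - β / 8 < mass P S) :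
    1 - β / 8 - 2 * (β / (8 * Real.log n)) * (Real.log n - Real.log S.card) ≤ mass P S := by
  have hlog : Real.log S.card ≤ Real.log n := by
    refine Real.log_le_log ?_ ?_
    · exact_mod_cast hS.card_pos
    · exact_mod_cast (card_finset_fin_le S)
  have h2 : 0 ≤ 2 * (β / (8 * Real.log n)) * (Real.log n - Real.log S.card) :=
    mul_nonneg (mul_nonneg (by norm_num) (div_nonneg hβ.le
      (mul_nonneg (by norm_num) (Real.log_natCast_nonneg _)))) (by linarith)
  linarith

lemma Invariant.step {C β : ℝ} (hC : 0 < C) (hn : 2 ≤ n) (hβ : 0 < β)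
    {P : Matrix (Fin n) (Fin n) ℝ} (hP : P.IsSymm) (h0 : ∀ i j, 0 ≤ P i j)
    (h1 : ∀ i, ∑ j, P i j = 1) {s s' : State n} (hstep : Step C P β s s')
    (hs : Invariant (1 / (128 * C)) P β s) : Invariant (1 / (128 * C)) P β s' := by
  have hε : 0 ≤ β / (8 * Real.log n) :=
    div_nonneg hβ.le (mul_nonneg (by norm_num) (Real.log_natCast_nonneg _))
  induction hstep with
  | exhausted 𝒮 =>
    refine ⟨Finset.univ, hs, by simp, fun R hne hR => ?_⟩
    exact absurd (Finset.subset_empty.1 hR) hne.ne_empty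
  | enterCut 𝒮 T S hT hfind hexp =>
    refine ⟨hs, hfind.nonempty, hfind.disjoint, one_sub_le_mass_of_lt hβ hfind.nonempty ?_⟩
    have := one_sub_mass_le_expansion hP h0 h1 hfind.nonempty hfind.ssubset
    linarith
  | enterRest 𝒮 T S hT hfind hexp hmass =>
    have hne : (Finset.univ \ T).Nonempty :=
      Finset.sdiff_nonempty.2 fun h => hT (Finset.univ_subset_iff.1 h)
    exact ⟨hs, hne, Finset.sdiff_disjoint, one_sub_le_mass_of_lt hβ hne hmass⟩
  | fail 𝒮 T S hT hfind hexp hmass =>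
    exact ⟨T, hs, rfl, fun R hne hR =>
      rest_expands hC hn hβ hP h0 h1 hs.weight_le hfind hexp hmass hne hR⟩
  | exitSmall 𝒮 T S hS =>
    obtain ⟨hout, hne, hdisj, hmass⟩ := hs
    refine hout.insert hP h0 h1 hdisj ⟨hne, one_sub_le_mass hn hβ hmass, fun R hR hRS => ?_⟩
    have := Finset.card_lt_card hRS
    have := hR.card_pos
    omega
  | exitBreak 𝒮 T S S' hS hfind hexp =>
    obtain ⟨hout, hne, hdisj, hmass⟩ := hs
    exact hout.insert hP h0 h1 hdisj ⟨hne, one_sub_le_mass hn hβ hmass,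
      fun R hR hRS => isComponent_of_break hC hn hβ hP h0 hfind hexp hR hRS⟩
  | keepCut 𝒮 T S S' hS hfind hexp hle =>
    obtain ⟨hout, hne, hdisj, hmass⟩ := hs
    refine ⟨hout, hfind.nonempty, hdisj.mono_left hfind.ssubset.subset, ?_⟩
    have := mass_le_mass_side hP hε hfind.nonempty hfind.ssubset hexp hle
    linarith
  | keepCompl 𝒮 T S S' hS hfind hexp hlt =>
    obtain ⟨hout, hne, hdisj, hmass⟩ := hs
    have hne' : (S \ S').Nonempty := Finset.sdiff_nonempty.2 hfind.ssubset.not_subset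
    refine ⟨hout, hne', hdisj.mono_left Finset.sdiff_subset, ?_⟩
    have := mass_le_mass_side hP hε hne'
      (Finset.sdiff_ssubset hfind.ssubset.subset hfind.nonempty)
      (by rwa [expansion_sdiff hP hfind.ssubset.subset])
      (by rw [Finset.sdiff_sdiff_eq_self hfind.ssubset.subset]; exact hlt.le)
    linarith

lemma invariant_start (c : ℝ) (P : Matrix (Fin n) (Fin n) ℝ) (β : ℝ) :
    Invariant c P β (start n) :=
  ⟨by simp, by simp, by simp, by simp [weight]⟩

lemma Reachable.invariant {C β : ℝ} (hC : 0 < C) (hn : 2 ≤ n) (hβ : 0 < β)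
    {P : Matrix (Fin n) (Fin n) ℝ} (hP : P.IsSymm) (h0 : ∀ i j, 0 ≤ P i j)
    (h1 : ∀ i, ∑ j, P i j = 1) {s : State n} (h : Reachable C P β s) :
    Invariant (1 / (128 * C)) P β s := by
  induction h with
  | refl => exact invariant_start _ P β
  | tail _ hstep ih => exact ih.step hC hn hβ hP h0 h1 hstep

/-- A bound for the number of steps that Partition Graph can still make. -/
def remaining : State n → ℕ
  | .outer _ T => (n - T.card) * (n + 2) + 1
  | .inner _ T S => (n - (T.card + 1)) * (n + 2) + S.card + 2
  | .done _ _ => 0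

lemma remaining_enter {𝒮 : Finset (Finset (Fin n))} {T : Finset (Fin n)} (S : Finset (Fin n))
    (hT : T ≠ Finset.univ) : remaining (.inner 𝒮 T S) < remaining (.outer 𝒮 T) := by
  have hS := card_finset_fin_le S
  have hlt : T.card < n := by
    have := Finset.card_lt_univ_of_notMem
      (Finset.exists_of_ssubset ((Finset.subset_univ T).ssubset_of_ne hT)).choose_spec.2
    rwa [Fintype.card_fin] at this
  have heq : n - T.card = n - (T.card + 1) + 1 := by omega
  simp only [remaining]
  rw [heq, add_mul]
  omega

lemma remaining_exit {𝒮 : Finset (Finset (Fin n))} (𝒮' : Finset (Finset (Fin n)))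
    {T S : Finset (Fin n)} (hne : S.Nonempty) (hdisj : Disjoint S T) :
    remaining (.outer 𝒮' (T ∪ S)) < remaining (.inner 𝒮 T S) := by
  have hS := hne.card_pos
  have hle : n - (T ∪ S).card ≤ n - (T.card + 1) := by
    rw [Finset.card_union_of_disjoint hdisj.symm]
    omega
  have := Nat.mul_le_mul_right (n + 2) hle
  simp only [remaining]
  omega

lemma remaining_lt {c C β : ℝ} {P : Matrix (Fin n) (Fin n) ℝ} {s s' : State n}
    (hstep : Step C P β s s') (hs : Invariant c P β s) : remaining s' < remaining s := by
  induction hstep with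
  | exhausted 𝒮 => exact Nat.succ_pos _
  | enterCut 𝒮 T S hT _ _ => exact remaining_enter S hT
  | enterRest 𝒮 T S hT _ _ _ => exact remaining_enter _ hT
  | fail 𝒮 T S _ _ _ _ => exact Nat.succ_pos _
  | exitSmall 𝒮 T S _ => exact remaining_exit _ hs.2.1 hs.2.2.1
  | exitBreak 𝒮 T S S' _ _ _ => exact remaining_exit _ hs.2.1 hs.2.2.1
  | keepCut 𝒮 T S S' _ hfind _ _ =>
    have := Finset.card_lt_card hfind.ssubset
    simp only [remaining]
    omega
  | keepCompl 𝒮 T S S' _ hfind _ _ =>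
    have := Finset.card_lt_card (Finset.sdiff_ssubset hfind.ssubset.subset hfind.nonempty)
    simp only [remaining]
    omega

lemma done_or_exists_step {c C β : ℝ} (hC : 72 ≤ C) (hn : 2 ≤ n)
    {P : Matrix (Fin n) (Fin n) ℝ} {s : State n} (hs : Invariant c P β s) :
    (∃ 𝒮 T, s = State.done 𝒮 T) ∨ ∃ s', Step C P β s s' := by
  rcases s with ⟨𝒮, T⟩ | ⟨𝒮, T, S⟩ | ⟨𝒮, T⟩
  · right
    by_cases hT : T = Finset.univ
    · subst hT
      exact ⟨_, .exhausted 𝒮⟩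
    obtain ⟨S, hS⟩ := exists_findComp hC P ((Finset.subset_univ T).ssubset_of_ne hT)
      (by simpa using hn)
    by_cases h1 : expansion P Finset.univ S < β / 8
    · exact ⟨_, .enterCut 𝒮 T S hT hS h1⟩
    by_cases h2 : 1 - β / 8 < mass P (Finset.univ \ T)
    · exact ⟨_, .enterRest 𝒮 T S hT hS (not_lt.1 h1) h2⟩
    · exact ⟨_, .fail 𝒮 T S hT hS (not_lt.1 h1) (not_lt.1 h2)⟩
  · right
    by_cases hcard : S.card ≤ 1
    · exact ⟨_, .exitSmall 𝒮 T S hcard⟩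
    obtain ⟨S', hS'⟩ := exists_findComp hC P (Finset.empty_ssubset.2 hs.2.1) (by omega)
    by_cases h1 : expansion P S S' < β / (8 * Real.log n)
    · by_cases h2 : mass P (S \ S') ≤ mass P S'
      · exact ⟨_, .keepCut 𝒮 T S S' (not_le.1 hcard) hS' h1 h2⟩
      · exact ⟨_, .keepCompl 𝒮 T S S' (not_le.1 hcard) hS' h1 (not_le.1 h2)⟩
    · exact ⟨_, .exitBreak 𝒮 T S S' (not_le.1 hcard) hS' (not_lt.1 h1)⟩
  · exact Or.inl ⟨𝒮, T, rfl⟩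

theorem alwaysReturns {C β : ℝ} (hC : 72 ≤ C) (hn : 2 ≤ n) (hβ : 0 < β)
    {P : Matrix (Fin n) (Fin n) ℝ} (hP : P.IsSymm) (h0 : ∀ i j, 0 ≤ P i j)
    (h1 : ∀ i, ∑ j, P i j = 1) : AlwaysReturns C P β := by
  have hinv : ∀ s, Reachable C P β s → Invariant (1 / (128 * C)) P β s :=
    fun s hs => hs.invariant (by linarith) hn hβ hP h0 h1
  refine ⟨fun s hs => done_or_exists_step hC hn (hinv s hs), ?_⟩
  rintro ⟨r, hr0, hr⟩
  have hreach : ∀ k, Reachable C P β (r k) := by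
    intro k
    induction k with
    | zero => rw [hr0]; exact Relation.ReflTransGen.refl
    | succ k ih => exact ih.tail (hr k)
  have hbound : ∀ k, remaining (r k) + k ≤ remaining (r 0) := by
    intro k
    induction k with
    | zero => exact le_rfl
    | succ k ih =>
      have := remaining_lt (hr k) (hinv _ (hreach k))
      omega
  have := hbound (remaining (r 0) + 1)
  omega

lemma OuterInvariant.isPartition {c β : ℝ} {P : Matrix (Fin n) (Fin n) ℝ}
    {𝒮 : Finset (Finset (Fin n))} {T : Finset (Fin n)} (h : OuterInvariant c P β 𝒮 T) :
    IsPartition 𝒮 (Finset.univ \ T) := by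
  refine ⟨fun S hS => (h.isComponent S hS).nonempty, h.disjoint, fun S hS => ?_, ?_⟩
  · have hST : S ⊆ T := h.sup_eq ▸ Finset.le_sup (f := id) hS
    exact Finset.disjoint_sdiff.mono_left hST
  · rw [h.sup_eq]
    exact Finset.union_sdiff_of_subset (Finset.subset_univ T)

end PartitionGraph

end

theorem mainTheorem3 :
    ∃ C₀ : ℝ, 0 < C₀ ∧ ∀ C : ℝ, C₀ ≤ C → ∃ c : ℝ, 0 < c ∧
      ∀ (n : ℕ), 2 ≤ n → ∀ (P : Matrix (Fin n) (Fin n) ℝ), P.IsSymm →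
        (∀ i j, 0 ≤ P i j) → (∀ i, ∑ j, P i j = 1) → ∀ (β : ℝ), 0 < β →
        PartitionGraph.AlwaysReturns C P β ∧
        ∀ (𝒮 : Finset (Finset (Fin n))) (T : Finset (Fin n)),
          PartitionGraph.Returns C P β 𝒮 T →
          (∀ S ∈ 𝒮, 1 - β ≤ (∑ i ∈ S, ∑ j ∈ S, P i j) / (S.card : ℝ)) ∧
          (∀ S ∈ 𝒮, ∀ R : Finset (Fin n), R.Nonempty → R ⊂ S →
            c * (β / Real.log n ^ 2) ≤
              (∑ i ∈ R, ∑ j ∈ S \ R, P i j) / (min R.card (S \ R).card : ℕ)) ∧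
          (∀ R : Finset (Fin n), R.Nonempty → R ⊆ T →
            c * (β / Real.log n) ≤ (∑ i ∈ R, ∑ j ∈ Rᶜ, P i j) / (R.card : ℝ)) ∧
          PartitionGraph.IsPartition 𝒮 T := by
  refine ⟨72, by norm_num, fun C hC => ⟨1 / (128 * C), by positivity, ?_⟩⟩
  intro n hn P hP h0 h1 β hβ
  refine ⟨PartitionGraph.alwaysReturns hC hn hβ hP h0 h1, fun 𝒮 U hret => ?_⟩
  obtain ⟨T, hinv, rfl, hrest⟩ :=
    PartitionGraph.Reachable.invariant (by linarith) hn hβ hP h0 h1 hret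
  refine ⟨fun S hS => (hinv.isComponent S hS).mass_ge,
    fun S hS => (hinv.isComponent S hS).expansion_ge, fun R hne hR => ?_, hinv.isPartition⟩
  rw [Finset.compl_eq_univ_sdiff]
  exact hrest R hne hR
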